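/- Let $FA=GF_2\langle a_1,\dots,a_k\rangle$ be the free associative algebra over the field with two elements. Every $f\in FA$ is a finite sum of distinct words in $a_1,\dots,a_k$; for $f\ne 0$ let $\deg f$ be the maximal length of a word of $f$, and let the top homogeneous part of $f$ be the sum of its words of length $\deg f$. A factor of a word is a block of consecutive letters at a given position. A word has period $q\ge 1$ if any two of its letters at distance $q$ are equal; a repetition in a word $W$ is a factor of $W$ that has some period $q\ge1$ and length at least $2q$. For words $U_1,\dots,U_n,X$ with $X$ nonempty, put $W=U_1XU_2X\cdots XU_n$, with its $n-1$ displayed appearances of $X$. We say that all the periodicity of $W$ is contained in the periodicity of $X$ if every repetition in $W$ lies in a factor of $W$ that contains exactly one of the displayed appearances of $X$ and has the least period of $X$ as a period. **Theorem 4.7.** Let $u_1,\dots,u_n,v_1,\dots,v_n\in FA$ be nonzero elements such that the top homogeneous part of each $u_i$ and each $v_i$ is a single word, $u_i^0$ and $v_i^0$ respectively, which has no factor $\alpha\alpha$ with $\alpha$ a nonempty word, and suppose that $u_i\neq v_i$ for at least one $i$. Suppose that the equation $$u_1xu_2xu_3\cdots u_{n-1}xu_n = v_1xv_2xv_3\cdots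 v_{n-1}xv_n$$ has a solution $x_1$ with $\deg x_1>2(\deg u_1+\dots+\deg u_n)^2$ such that, for (every word $x_1^0$ of) the top homogeneous part of $x_1$, all the periodicity of $u_1^0x_1^0u_2^0\cdots x_1^0u_n^0$ and all the periodicity of $v_1^0x_1^0v_2^0\cdots x_1^0v_n^0$ is contained in the periodicity of $x_1^0$. Then there exist nonzero $s,t\in FA$ with $\deg s=\deg t\le\max_i\deg u_i$ such that: 1. every solution $x\in FA$ of $sx=xt$ is a solution of the given equation; 2. every solution $x_2$ of the given equation with $$\deg x_2>2\left(2+2^{\deg s+2}\right)+2\left(\deg u_1+\dots+\deg u_n\right)^2$$ is a solution of $sx=xt$. -/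

import Mathlib

/-- The free associative algebra `GF₂⟨a₁, …, a_k⟩`. -/
abbrev FA (k : ℕ) : Type := FreeAlgebra (ZMod 2) (Fin k)

namespace FA

/-- The finite set of words in `a₁, …, a_k` whose coefficient in `f` is nonzero
(so that `f` is the sum of these words). -/
noncomputable def words {k : ℕ} (f : FA k) : Finset (List (Fin k)) :=
  (FreeAlgebra.equivMonoidAlgebraFreeMonoid f).coeff.support.map
    (FreeMonoid.toList (α := Fin k)).toEmbedding

/-- The degree of `f`: the largest length of a word of `f` (with the value `0` at `f = 0`). -/
noncomputable def deg {k : ℕ} (f : FA k) : ℕ := (words f).sup List.length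

/-- The words of the top homogeneous part of `f`. -/
noncomputable def topWords {k : ℕ} (f : FA k) : Finset (List (Fin k)) :=
  (words f).filter (fun w => w.length = deg f)

/-- The element `u₁ x u₂ x ⋯ x uₙ`. -/
def side {k n : ℕ} (u : Fin n → FA k) (x : FA k) : FA k :=
  ((List.ofFn u).intersperse x).prod

end FA

namespace Words

variable {α : Type*}

/-- A word has no periodicity if it has no factor `β β` with `β` nonempty. -/
def SquareFree (w : List α) : Prop :=
  ∀ β : List α, β ≠ [] → ¬ (β ++ β) <:+: w

/-- The word `U₁ X U₂ X ⋯ X Uₙ`. -/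
def side {n : ℕ} (U : Fin n → List α) (X : List α) : List α :=
  ((List.ofFn U).intersperse X).flatten

/-- The position in `U₁ X U₂ X ⋯ X Uₙ` at which the appearance of `X` between the coefficients
with the (zero-based) indices `j` and `j + 1` starts. -/
def appearance {n : ℕ} (U : Fin n → List α) (X : List α) (j : ℕ) : ℕ :=
  (((List.ofFn U).take (j + 1)).map List.length).sum + j * X.length

/-- All the periodicity of the word `W = U₁ X U₂ X ⋯ X Uₙ` is contained in the periodicity of `X`.
The factor of `W` that occupies the positions `a, …, b - 1` is a repetition if it has a period `q`
and length at least `2 q`. Each such factor has to lie in a factor of `W` (occupying the positions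
`c, …, d - 1`) that contains exactly one of the appearances of `X` and continues the periodicity
of that appearance, i.e. has the least period `p` of `X` as a period. -/
def PeriodicityContained {n : ℕ} (U : Fin n → List α) (X : List α) : Prop :=
  ∀ a b q : ℕ, 0 < q → a + 2 * q ≤ b → b ≤ (side U X).length →
    ((side U X).extract a b).HasPeriod q →
    ∃ c d p : ℕ, c ≤ a ∧ b ≤ d ∧ d ≤ (side U X).length ∧
      IsLeast {p : ℕ | 0 < p ∧ X.HasPeriod p} p ∧
      ((side U X).extract c d).HasPeriod p ∧
      ∃! j : ℕ, j + 1 < n ∧ c ≤ appearance U X j ∧ appearance U X j + X.length ≤ d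

end Words

/-!
The argument compares the equation with its leading words, and has three ingredients.

*The coefficients give `s`.* After cancelling the common beginning of the two sides, the equation
reads `a x A = b x B` with `a ≠ b`. Division of the coefficient of larger degree by the other one
(or by the difference `a + b`, if the degrees agree) leaves no remainder: the top word of `x` is a
prefix of `S S S ⋯`, where `S` is the top word of the quotient `s`, and a remainder would put a
nonempty prefix of it in front of `S` inside a square-free word, which creates a square
(`Words.not_squareFree_prefix_append`). Hence `s` depends on the coefficients only, and each nonzero
solution `y` satisfies a relation `s y A' = y B'` with `A' ≠ 0`
(`FA.exists_splits`, `FA.Splits.exists_conjugate`).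

*From `s y A = y B` to `s y = y t`.* This implication holds for all `s, y` whose top part is a single
word (`FA.exists_conjugate`). The Euclidean algorithm writes `s = h s'`, `y = h y'` with
`s' g = y' l`, where `g` is a left factor of `y A`, and `g`, `y'` have the same degree and the same
image under `FA.collapse`, the homomorphism to `GF₂[X]` that sends every letter to `X`. The
remainder of the division of `y` by `g` again has a single top word, so that its degree can be read
off in `GF₂[X]`; as its image there is a multiple of the image of `y'`, it is zero. So `y = g q`,
and `s y = h s' g q = h y' l q = y (l q)`. By the symmetry `star`, which reverses words, the last
pair of distinct coefficients yields `t'` with `s' y = y t'` for each solution `y`, where `s'` may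
depend on `y`. A period argument (`FA.eq_or_eq_add_one`) shows that `t` equals `t'` or `t' + 1` if
`deg y` is large. Since `s` and `t` have the same image in `GF₂[X]`, only one of the two is possible
and `t` is the same for all large solutions.

*All solutions of `s x = x t` solve the equation.* Modulo `s x = x t` the difference of the two sides
is a combination of terms `w₁ x w₂ x ⋯ x c` where the words `w₁, w₂, …` do not end with `S`
(`FA.IsForm.hasNormalForm`). For a long solution the elements `w x` with such words `w` are right
linearly independent, since the appearances of its top word, which has the period `S`, can be
shifted only by multiples of the length of `S` (`FA.eq_zero_of_sum_eq_zero`). As the difference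
vanishes at the given solution, its normal form is zero, and it vanishes at all solutions of
`s x = x t` (`FA.IsForm.eq_zero`). The bound for `deg s` follows from the same rigidity: the
degrees of corresponding coefficients are congruent modulo `deg s` (`FA.deg_modEq`).
-/

/-! ### Words and top homogeneous parts of elements of the free algebra -/

namespace FA

variable {k : ℕ}

/-- The coefficient of the word `w` in `f`. -/
noncomputable def coef (f : FA k) (w : List (Fin k)) : ZMod 2 :=
  (FreeAlgebra.equivMonoidAlgebraFreeMonoid f).coeff (FreeMonoid.ofList w)

/-- The word `w` as an element of the free algebra. -/
noncomputable def mon (w : List (Fin k)) : FA k := (w.map (FreeAlgebra.ι (ZMod 2))).prod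

/-- The sum of a finite set of words. -/
noncomputable def poly (s : Finset (List (Fin k))) : FA k := ∑ w ∈ s, mon w

theorem mem_words {f : FA k} {w : List (Fin k)} : w ∈ words f ↔ coef f w ≠ 0 := by
  simp only [words, Finset.mem_map, coef, Finsupp.mem_support_iff]
  constructor
  · rintro ⟨a, ha, rfl⟩
    exact ha
  · intro h
    exact ⟨FreeMonoid.ofList w, h, rfl⟩

theorem coef_add (f g : FA k) (w : List (Fin k)) : coef (f + g) w = coef f w + coef g w := by
  simp [coef]

theorem coef_zero (w : List (Fin k)) : coef (0 : FA k) w = 0 := by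
  simp [coef]

theorem coef_sum {ι : Type*} (s : Finset ι) (f : ι → FA k) (w : List (Fin k)) :
    coef (∑ i ∈ s, f i) w = ∑ i ∈ s, coef (f i) w := by
  classical
  induction s using Finset.induction_on with
  | empty => simp [coef_zero]
  | insert a s ha ih => rw [Finset.sum_insert ha, Finset.sum_insert ha, coef_add, ih]

theorem mon_append (u w : List (Fin k)) : mon (u ++ w) = mon u * mon w := by
  simp [mon]

@[simp] theorem mon_nil : mon ([] : List (Fin k)) = 1 := by simp [mon]

theorem equiv_mon (w : List (Fin k)) :
    FreeAlgebra.equivMonoidAlgebraFreeMonoid (mon w)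
      = MonoidAlgebra.single (FreeMonoid.ofList w) (1 : ZMod 2) := by
  induction w with
  | nil => simp [MonoidAlgebra.one_def]
  | cons a w ih =>
    have : mon (a :: w) = FreeAlgebra.ι (ZMod 2) a * mon w := by simp [mon]
    rw [this, map_mul, ih]
    simp [FreeAlgebra.equivMonoidAlgebraFreeMonoid, MonoidAlgebra.single_mul_single]

theorem coef_mon (u w : List (Fin k)) : coef (mon u) w = if u = w then 1 else 0 := by
  classical
  rw [coef, equiv_mon, MonoidAlgebra.coeff_single, Finsupp.single_apply]
  simp

theorem ext_coef {f g : FA k} (h : ∀ w, coef f w = coef g w) : f = g := by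
  apply FreeAlgebra.equivMonoidAlgebraFreeMonoid.injective
  ext w
  exact h (FreeMonoid.toList w)

theorem coef_poly (s : Finset (List (Fin k))) (w : List (Fin k)) :
    coef (poly s) w = if w ∈ s then 1 else 0 := by
  simp [poly, coef_sum, coef_mon]

theorem words_poly (s : Finset (List (Fin k))) : words (poly s) = s := by
  ext w
  rw [mem_words, coef_poly]
  simp

theorem coef_eq_ite (f : FA k) (w : List (Fin k)) : coef f w = if w ∈ words f then 1 else 0 := by
  split_ifs with h
  · rw [mem_words] at h
    generalize coef f w = c at h
    revert h
    revert c
    decide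
  · rw [mem_words] at h
    exact not_not.mp h

theorem poly_words (f : FA k) : poly (words f) = f :=
  ext_coef fun w => by rw [coef_poly, coef_eq_ite f w]

theorem words_injective {f g : FA k} (h : words f = words g) : f = g := by
  rw [← poly_words f, h, poly_words]

theorem words_nonempty {f : FA k} (hf : f ≠ 0) : (words f).Nonempty := by
  rw [Finset.nonempty_iff_ne_empty]
  intro h
  apply hf
  rw [← poly_words f, h]
  simp [poly]

theorem length_le_deg {f : FA k} {w : List (Fin k)} (h : w ∈ words f) : w.length ≤ deg f :=
  Finset.le_sup (f := List.length) h

theorem deg_le {f : FA k} {n : ℕ} (h : ∀ w ∈ words f, w.length ≤ n) : deg f ≤ n :=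
  Finset.sup_le h

theorem mem_topWords {f : FA k} {w : List (Fin k)} :
    w ∈ topWords f ↔ w ∈ words f ∧ w.length = deg f := by
  simp [topWords]

theorem topWords_nonempty {f : FA k} (hf : f ≠ 0) : (topWords f).Nonempty := by
  obtain ⟨w, hw, h⟩ := Finset.exists_mem_eq_sup _ (words_nonempty hf) List.length
  exact ⟨w, mem_topWords.2 ⟨hw, h.symm⟩⟩

@[simp] theorem deg_zero : deg (0 : FA k) = 0 := by
  have : words (0 : FA k) = ∅ := by
    ext w
    simp [mem_words, coef_zero]
  simp [deg, this]

theorem ne_zero_of_mem {f : FA k} {w : List (Fin k)} (h : w ∈ topWords f) : f ≠ 0 := by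
  rintro rfl
  have := (mem_topWords.1 h).1
  rw [mem_words] at this
  exact this (coef_zero w)

theorem words_one : words (1 : FA k) = {[]} := by
  have : (1 : FA k) = poly {[]} := by simp [poly]
  rw [this, words_poly]

@[simp] theorem deg_one : deg (1 : FA k) = 0 := by
  simp [deg, words_one]

theorem topWords_one : topWords (1 : FA k) = {[]} := by
  ext w
  simp only [mem_topWords, words_one, deg_one, Finset.mem_singleton]
  constructor
  · exact fun h => h.1
  · rintro rfl
    simp

theorem eq_one_of_deg_eq_zero {f : FA k} (hf : f ≠ 0) (h : deg f = 0) : f = 1 := by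
  apply words_injective
  rw [words_one]
  have h0 : ∀ w ∈ words f, w = [] := fun w hw => by
    have := length_le_deg hw
    rw [h] at this
    exact List.length_eq_zero_iff.1 (by omega)
  obtain ⟨w, hw⟩ := words_nonempty hf
  ext v
  rw [Finset.mem_singleton]
  constructor
  · exact h0 v
  · rintro rfl
    rw [← h0 w hw]
    exact hw

theorem words_add_subset (f g : FA k) : words (f + g) ⊆ words f ∪ words g := by
  intro w hw
  rw [Finset.mem_union]
  by_contra! h
  rw [mem_words, coef_add, coef_eq_ite f, coef_eq_ite g, if_neg h.1, if_neg h.2] at hw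
  simp at hw

theorem deg_add_le (f g : FA k) : deg (f + g) ≤ max (deg f) (deg g) := by
  apply deg_le
  intro w hw
  rcases Finset.mem_union.1 (words_add_subset f g hw) with h | h
  · exact (length_le_deg h).trans (le_max_left _ _)
  · exact (length_le_deg h).trans (le_max_right _ _)

theorem add_self (f : FA k) : f + f = 0 :=
  ext_coef fun w => by
    rw [coef_add, coef_zero]
    generalize coef f w = c
    revert c
    decide

theorem eq_of_add_eq_zero {f g : FA k} (h : f + g = 0) : f = g := by
  have : f + g + g = g := by rw [h, zero_add]
  rwa [add_assoc, add_self, add_zero] at this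

theorem add_add_self (f g : FA k) : f + g + g = f := by
  rw [add_assoc, add_self, add_zero]

/-- The coefficient of a product at a word of the largest possible length only involves one
splitting of that word. -/
theorem coef_mul {f g : FA k} {m n : ℕ} (hf : deg f ≤ m) (hg : deg g ≤ n) {w : List (Fin k)}
    (hw : w.length = m + n) : coef (f * g) w = coef f (w.take m) * coef g (w.drop m) := by
  classical
  conv_lhs => rw [← poly_words f, ← poly_words g]
  rw [poly, poly, Finset.sum_mul_sum, coef_sum]
  simp_rw [coef_sum, ← mon_append, coef_mon]
  have key : ∀ u ∈ words f, ∀ v ∈ words g, (u ++ v = w ↔ u = w.take m ∧ v = w.drop m) := by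
    intro u hu v hv
    have h1 := length_le_deg hu
    have h2 := length_le_deg hv
    constructor
    · intro h
      have h3 := congrArg List.length h
      rw [List.length_append] at h3
      have : u.length = m := by omega
      subst this
      rw [← h]
      simp
    · rintro ⟨rfl, rfl⟩
      exact List.take_append_drop _ _
  have : ∀ u ∈ words f, (∑ v ∈ words g, if u ++ v = w then (1 : ZMod 2) else 0)
      = if u = w.take m then coef g (w.drop m) else 0 := by
    intro u hu
    rw [coef_eq_ite g]
    by_cases h : u = w.take m
    · rw [if_pos h, ← Finset.sum_ite_eq' (words g) (w.drop m) (fun _ => (1 : ZMod 2))]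
      apply Finset.sum_congr rfl
      intro v hv
      exact if_congr ((key u hu v hv).trans (and_iff_right h)) rfl rfl
    · rw [if_neg h]
      apply Finset.sum_eq_zero
      intro v hv
      rw [if_neg]
      rw [key u hu v hv]
      exact fun h' => h h'.1
  rw [Finset.sum_congr rfl this, Finset.sum_ite_eq', coef_eq_ite f]
  split_ifs <;> simp

theorem exists_append_of_mem_words_mul {f g : FA k} {w : List (Fin k)} (hw : w ∈ words (f * g)) :
    ∃ u ∈ words f, ∃ v ∈ words g, w = u ++ v := by
  classical
  by_contra! h
  rw [mem_words] at hw
  apply hw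
  conv_lhs => rw [← poly_words f, ← poly_words g]
  rw [poly, poly, Finset.sum_mul_sum, coef_sum]
  simp_rw [coef_sum, ← mon_append, coef_mon]
  apply Finset.sum_eq_zero
  intro u hu
  apply Finset.sum_eq_zero
  intro v hv
  rw [if_neg]
  exact fun e => h u hu v hv e.symm

theorem deg_mul_le (f g : FA k) : deg (f * g) ≤ deg f + deg g := by
  apply deg_le
  intro w hw
  obtain ⟨u, hu, v, hv, rfl⟩ := exists_append_of_mem_words_mul hw
  have h1 := length_le_deg hu
  have h2 := length_le_deg hv
  rw [List.length_append]
  omega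

theorem append_mem_words_mul {f g : FA k} {u v : List (Fin k)} (hu : u ∈ topWords f)
    (hv : v ∈ topWords g) : u ++ v ∈ words (f * g) := by
  rw [mem_topWords] at hu hv
  rw [mem_words, coef_mul le_rfl le_rfl (by rw [List.length_append, hu.2, hv.2]), ← hu.2]
  simp only [List.take_left, List.drop_left]
  exact mul_ne_zero (mem_words.1 hu.1) (mem_words.1 hv.1)

theorem deg_mul {f g : FA k} (hf : f ≠ 0) (hg : g ≠ 0) : deg (f * g) = deg f + deg g := by
  apply le_antisymm (deg_mul_le f g)
  obtain ⟨u, hu⟩ := topWords_nonempty hf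
  obtain ⟨v, hv⟩ := topWords_nonempty hg
  have := length_le_deg (append_mem_words_mul hu hv)
  rw [List.length_append, (mem_topWords.1 hu).2, (mem_topWords.1 hv).2] at this
  exact this

theorem mem_topWords_mul {f g : FA k} (hf : f ≠ 0) (hg : g ≠ 0) {w : List (Fin k)} :
    w ∈ topWords (f * g) ↔ ∃ u ∈ topWords f, ∃ v ∈ topWords g, w = u ++ v := by
  constructor
  · intro h
    rw [mem_topWords, deg_mul hf hg] at h
    obtain ⟨u, hu, v, hv, rfl⟩ := exists_append_of_mem_words_mul h.1
    have h1 := length_le_deg hu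
    have h2 := length_le_deg hv
    have h3 := h.2
    rw [List.length_append] at h3
    exact ⟨u, mem_topWords.2 ⟨hu, by omega⟩, v, mem_topWords.2 ⟨hv, by omega⟩, rfl⟩
  · rintro ⟨u, hu, v, hv, rfl⟩
    refine mem_topWords.2 ⟨append_mem_words_mul hu hv, ?_⟩
    rw [deg_mul hf hg, List.length_append, (mem_topWords.1 hu).2, (mem_topWords.1 hv).2]

theorem append_mem_topWords_mul {f g : FA k} {u v : List (Fin k)} (hu : u ∈ topWords f)
    (hv : v ∈ topWords g) : u ++ v ∈ topWords (f * g) :=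
  (mem_topWords_mul (ne_zero_of_mem hu) (ne_zero_of_mem hv)).2 ⟨u, hu, v, hv, rfl⟩

theorem length_of_mem_topWords {f : FA k} {w : List (Fin k)} (h : w ∈ topWords f) :
    w.length = deg f := (mem_topWords.1 h).2

theorem topWords_poly {s : Finset (List (Fin k))} {n : ℕ} (hs : s.Nonempty)
    (h : ∀ w ∈ s, w.length = n) : topWords (poly s) = s ∧ deg (poly s) = n := by
  have hd : deg (poly s) = n := by
    apply le_antisymm
    · apply deg_le
      intro w hw
      rw [words_poly] at hw
      exact (h w hw).le
    · obtain ⟨w, hw⟩ := hs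
      rw [← h w hw]
      apply length_le_deg
      rwa [words_poly]
  refine ⟨?_, hd⟩
  ext w
  rw [mem_topWords, words_poly, hd]
  exact ⟨fun h' => h'.1, fun h' => ⟨h', h w h'⟩⟩

theorem deg_eq_of_topWords_eq {f g : FA k} (hf : f ≠ 0) (h : topWords f = topWords g) :
    deg f = deg g := by
  obtain ⟨w, hw⟩ := topWords_nonempty hf
  rw [← length_of_mem_topWords hw, length_of_mem_topWords (h ▸ hw)]

/-- If the top homogeneous parts agree, they cancel in the sum. -/
theorem add_eq_zero_or_deg_add_lt {f g : FA k} (hf : f ≠ 0) (h : topWords f = topWords g) :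
    f + g = 0 ∨ deg (f + g) < deg f := by
  by_cases h0 : f + g = 0
  · exact Or.inl h0
  right
  have hd := deg_eq_of_topWords_eq hf h
  have hle := deg_add_le f g
  rw [← hd, max_self] at hle
  rcases hle.lt_or_eq with h1 | h1
  · exact h1
  exfalso
  obtain ⟨w, hw⟩ := topWords_nonempty h0
  rw [mem_topWords, h1, mem_words, coef_add, coef_eq_ite f, coef_eq_ite g] at hw
  have : w ∈ words f ↔ w ∈ words g := by
    have h2 : w ∈ topWords f ↔ w ∈ topWords g := by rw [h]
    rw [mem_topWords, mem_topWords, ← hd] at h2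
    simpa [hw.2] using h2
  apply hw.1
  simp only [this]
  split_ifs
  · decide
  · simp

theorem topWords_add_of_lt {f g : FA k} (h : g = 0 ∨ deg g < deg f) :
    topWords (f + g) = topWords f := by
  rcases h with rfl | h
  · rw [add_zero]
  have key : ∀ w : List (Fin k), deg f ≤ w.length → (w ∈ words (f + g) ↔ w ∈ words f) := by
    intro w hw
    have : w ∉ words g := fun h' => by
      have := length_le_deg h'
      omega
    rw [mem_words, coef_add, coef_eq_ite g, if_neg this, add_zero, mem_words]
  have hd : deg (f + g) = deg f := by
    apply le_antisymm
    · exact (deg_add_le f g).trans (by omega)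
    · by_cases hf : f = 0
      · simp [hf] at h
      obtain ⟨w, hw⟩ := topWords_nonempty hf
      rw [mem_topWords] at hw
      rw [← hw.2]
      exact length_le_deg ((key w hw.2.ge).2 hw.1)
  ext w
  rw [mem_topWords, mem_topWords, hd]
  constructor
  · exact fun h' => ⟨(key w h'.2.ge).1 h'.1, h'.2⟩
  · exact fun h' => ⟨(key w h'.2.ge).2 h'.1, h'.2⟩

theorem topWords_eq_of_deg_add_lt {f g : FA k} (h : f + g = 0 ∨ deg (f + g) < deg f) :
    topWords g = topWords f := by
  have : g = f + (f + g) := by rw [← add_assoc, add_self, zero_add]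
  rw [this]
  exact topWords_add_of_lt h

/-- `IsSingle f` says that the top homogeneous part of `f` is a single word. -/
def IsSingle (f : FA k) : Prop := ∃ w, topWords f = {w}

theorem IsSingle.ne_zero {f : FA k} (h : IsSingle f) : f ≠ 0 := by
  obtain ⟨w, hw⟩ := h
  exact ne_zero_of_mem (w := w) (by simp [hw])

theorem isSingle_iff {f : FA k} : IsSingle f ↔ f ≠ 0 ∧
    ∀ u ∈ topWords f, ∀ v ∈ topWords f, u = v := by
  constructor
  · intro h
    refine ⟨h.ne_zero, ?_⟩
    obtain ⟨w, hw⟩ := h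
    simp [hw]
  · rintro ⟨h0, h⟩
    obtain ⟨w, hw⟩ := topWords_nonempty h0
    exact ⟨w, Finset.eq_singleton_iff_unique_mem.2 ⟨hw, fun x hx => h x hx w hw⟩⟩

theorem topWords_mul_single {f g : FA k} {u v : List (Fin k)} (hf : topWords f = {u})
    (hg : topWords g = {v}) : topWords (f * g) = {u ++ v} := by
  ext w
  rw [mem_topWords_mul (IsSingle.ne_zero ⟨u, hf⟩) (IsSingle.ne_zero ⟨v, hg⟩)]
  simp [hf, hg]

theorem IsSingle.mul {f g : FA k} (hf : IsSingle f) (hg : IsSingle g) : IsSingle (f * g) := by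
  obtain ⟨u, hu⟩ := hf
  obtain ⟨v, hv⟩ := hg
  exact ⟨_, topWords_mul_single hu hv⟩

theorem IsSingle.of_mul_right {f g : FA k} (h : IsSingle (f * g)) : IsSingle g := by
  have h0 := h.ne_zero
  have hf := left_ne_zero_of_mul h0
  have hg := right_ne_zero_of_mul h0
  rw [isSingle_iff] at h ⊢
  refine ⟨hg, fun u hu v hv => ?_⟩
  obtain ⟨w, hw⟩ := topWords_nonempty hf
  exact List.append_cancel_left (h.2 _ (append_mem_topWords_mul hw hu) _
    (append_mem_topWords_mul hw hv))

/-- If `f * a = g * b` and `deg g ≤ deg f` then every top word of `f` starts with a top word of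
`g`. -/
theorem prefix_of_mul_eq_mul {f g a b : FA k} (h : f * a = g * b) (ha : a ≠ 0)
    (hb : b ≠ 0) (hd : deg g ≤ deg f) {u : List (Fin k)} (hu : u ∈ topWords f) :
    ∃ v ∈ topWords g, v <+: u := by
  obtain ⟨w, hw⟩ := topWords_nonempty ha
  have := append_mem_topWords_mul hu hw
  have hg : g ≠ 0 := by
    rintro rfl
    rw [zero_mul] at h
    exact (mul_ne_zero (ne_zero_of_mem hu) ha) h
  rw [h, mem_topWords_mul hg hb] at this
  obtain ⟨v, hv, z, -, e⟩ := this
  refine ⟨v, hv, List.prefix_of_prefix_length_le (l₃ := u ++ w) ?_ ?_ ?_⟩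
  · rw [e]; exact List.prefix_append _ _
  · exact List.prefix_append _ _
  · rw [length_of_mem_topWords hu, length_of_mem_topWords hv]; exact hd

theorem prefix_of_mul_eq_mul' {f g a b : FA k} (h : f * a = g * b) (ha : a ≠ 0)
    (hb : b ≠ 0) (hd : deg g ≤ deg f) {v : List (Fin k)} (hv : v ∈ topWords g) :
    ∃ u ∈ topWords f, v <+: u := by
  obtain ⟨w, hw⟩ := topWords_nonempty hb
  have := append_mem_topWords_mul hv hw
  have hf : f ≠ 0 := by
    rintro rfl
    rw [zero_mul] at h
    exact (mul_ne_zero (ne_zero_of_mem hv) hb) h.symm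
  rw [← h, mem_topWords_mul hf ha] at this
  obtain ⟨u, hu, z, -, e⟩ := this
  refine ⟨u, hu, List.prefix_of_prefix_length_le (l₃ := v ++ w) ?_ ?_ ?_⟩
  · exact List.prefix_append _ _
  · rw [e]; exact List.prefix_append _ _
  · rw [length_of_mem_topWords hu, length_of_mem_topWords hv]; exact hd

theorem isSingle_of_mul_eq_mul {f g a b : FA k} (h : f * a = g * b) (ha : a ≠ 0) (hb : b ≠ 0)
    (hd : deg g ≤ deg f) (hf : IsSingle f) : IsSingle g := by
  have hg : g ≠ 0 := by
    rintro rfl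
    rw [zero_mul] at h
    exact (mul_ne_zero hf.ne_zero ha) h
  obtain ⟨w, hw⟩ := hf
  rw [isSingle_iff]
  refine ⟨hg, fun u hu v hv => ?_⟩
  obtain ⟨u', hu', h1⟩ := prefix_of_mul_eq_mul' h ha hb hd hu
  obtain ⟨v', hv', h2⟩ := prefix_of_mul_eq_mul' h ha hb hd hv
  rw [hw, Finset.mem_singleton] at hu' hv'
  subst hu' hv'
  exact (List.prefix_of_prefix_length_le h1 h2 (by
    rw [length_of_mem_topWords hu, length_of_mem_topWords hv])).eq_of_length (by
    rw [length_of_mem_topWords hu, length_of_mem_topWords hv])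

/-- One step of division: the top homogeneous part of `f` can be removed. -/
theorem exists_quotient_step {f g a b : FA k} (h : f * a = g * b) (hf : f ≠ 0) (ha : a ≠ 0)
    (hg : IsSingle g) (hd : deg g ≤ deg f) :
    ∃ q : FA k, q ≠ 0 ∧ topWords f = topWords (g * q) := by
  classical
  have hb : b ≠ 0 := by
    rintro rfl
    rw [mul_zero] at h
    exact (mul_ne_zero hf ha) h
  obtain ⟨v, hv⟩ := hg
  have hvm : v ∈ topWords g := by simp [hv]
  have hpre : ∀ u ∈ topWords f, v <+: u := fun u hu => by
    obtain ⟨v', hv', h'⟩ := prefix_of_mul_eq_mul h ha hb hd hu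
    rw [hv, Finset.mem_singleton] at hv'
    rwa [← hv']
  set Q := (topWords f).image (fun u => u.drop v.length) with hQ
  have hQn : Q.Nonempty := (topWords_nonempty hf).image _
  have hQl : ∀ w ∈ Q, w.length = deg f - v.length := by
    intro w hw
    obtain ⟨u, hu, rfl⟩ := Finset.mem_image.1 hw
    rw [List.length_drop, length_of_mem_topWords hu]
  obtain ⟨h1, h2⟩ := topWords_poly hQn hQl
  have hq : poly Q ≠ 0 := by
    obtain ⟨w, hw⟩ := hQn
    exact ne_zero_of_mem (w := w) (by rwa [h1])
  refine ⟨poly Q, hq, ?_⟩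
  ext u
  rw [mem_topWords_mul (ne_zero_of_mem hvm) hq, hv, h1]
  simp only [Finset.mem_singleton, exists_eq_left, hQ, Finset.mem_image]
  constructor
  · intro hu
    refine ⟨_, ⟨u, hu, rfl⟩, ?_⟩
    obtain ⟨z, rfl⟩ := hpre u hu
    simp
  · rintro ⟨_, ⟨u', hu', rfl⟩, rfl⟩
    obtain ⟨z, rfl⟩ := hpre u' hu'
    simpa using hu'

/-- Division with remainder, available because `f` and `g` have a common right multiple. -/
theorem exists_division {g : FA k} (hg : IsSingle g) {a : FA k} (ha : a ≠ 0) (f b : FA k)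
    (h : f * a = g * b) : ∃ q r : FA k, f = g * q + r ∧ (r = 0 ∨ deg r < deg g) := by
  induction hn : deg f using Nat.strong_induction_on generalizing f b with
  | _ n ih =>
  subst hn
  by_cases hf : f = 0
  · exact ⟨0, 0, by simp [hf], Or.inl rfl⟩
  rcases lt_or_ge (deg f) (deg g) with hd | hd
  · exact ⟨0, f, by simp, Or.inr hd⟩
  obtain ⟨q, hq, hq'⟩ := exists_quotient_step h hf ha hg hd
  rcases add_eq_zero_or_deg_add_lt hf hq' with h0 | h0
  · exact ⟨q, 0, by rw [add_zero]; exact eq_of_add_eq_zero h0, Or.inl rfl⟩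
  · obtain ⟨q', r, e, hr⟩ := ih _ h0 (f + g * q) (b + q * a)
      (by rw [add_mul, h, mul_add, mul_assoc]) rfl
    refine ⟨q' + q, r, ?_, hr⟩
    rw [mul_add, add_right_comm, ← e, add_add_self]

end FA

/-! ### The Euclidean algorithm -/

namespace FA

variable {k : ℕ}

/-- The homomorphism to the commutative domain `GF₂[X]` that maps every letter to `X`. -/
noncomputable def collapse (k : ℕ) : FA k →ₐ[ZMod 2] Polynomial (ZMod 2) :=
  FreeAlgebra.lift (ZMod 2) fun _ => Polynomial.X

theorem collapse_mon (w : List (Fin k)) : collapse k (mon w) = Polynomial.X ^ w.length := by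
  induction w with
  | nil => simp
  | cons a w ih =>
    have : mon (a :: w) = FreeAlgebra.ι (ZMod 2) a * mon w := by simp [mon]
    rw [this, map_mul, ih, List.length_cons, pow_succ']
    simp [collapse]

theorem coeff_collapse (f : FA k) (n : ℕ) :
    (collapse k f).coeff n = ((words f).filter (fun w => w.length = n)).card := by
  conv_lhs => rw [← poly_words f]
  simp only [poly, map_sum, collapse_mon, Polynomial.finsetSum_coeff, Polynomial.coeff_X_pow]
  rw [Finset.card_filter]
  push_cast
  exact Finset.sum_congr rfl fun w _ => by simp only [eq_comm]

theorem natDegree_collapse_le (f : FA k) : (collapse k f).natDegree ≤ deg f := by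
  rw [Polynomial.natDegree_le_iff_coeff_eq_zero]
  intro n hn
  rw [coeff_collapse, Finset.card_eq_zero.2, Nat.cast_zero]
  rw [Finset.filter_eq_empty_iff]
  intro w hw h
  have := length_le_deg hw
  omega

theorem IsSingle.collapse_ne_zero {f : FA k} (hf : IsSingle f) : collapse k f ≠ 0 := by
  obtain ⟨w, hw⟩ := hf
  intro h
  have := coeff_collapse f (deg f)
  rw [h] at this
  change (0 : ZMod 2) = ((topWords f).card : ZMod 2) at this
  rw [hw] at this
  simp at this

theorem IsSingle.natDegree_collapse {f : FA k} (hf : IsSingle f) :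
    (collapse k f).natDegree = deg f := by
  apply le_antisymm (natDegree_collapse_le f)
  apply Polynomial.le_natDegree_of_ne_zero
  obtain ⟨w, hw⟩ := hf
  rw [coeff_collapse]
  change ((topWords f).card : ZMod 2) ≠ 0
  rw [hw]
  simp

/-- The conclusion of the Euclidean algorithm for the relation `f * a = g * b`: after the removal
of a common left factor `h` of `f, g` and a common right factor `m` of `a, b` the two sides of the
relation agree crosswise in degree and in their images in the commutative ring `GF₂[X]`. -/
def Reduces (f g a b : FA k) : Prop :=
  ∃ h f' g' a' b' m : FA k, f = h * f' ∧ g = h * g' ∧ a = a' * m ∧ b = b' * m ∧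
    f' * a' = g' * b' ∧ collapse k f' = collapse k b' ∧ collapse k g' = collapse k a' ∧
    deg f' = deg b' ∧ deg g' = deg a'

theorem Reduces.symm {f g a b : FA k} (h : Reduces f g a b) : Reduces g f b a := by
  obtain ⟨h, f', g', a', b', m, h1, h2, h3, h4, h5, h6, h7, h8, h9⟩ := h
  exact ⟨h, g', f', b', a', m, h2, h1, h4, h3, h5.symm, h7, h6, h9, h8⟩

/-- It suffices to subtract multiples of `g` from `f` one homogeneous part at a time. The top word of
the element of smaller degree stays unique throughout. -/
theorem reduces_aux (N : ℕ) : ∀ f g a b : FA k, deg f + deg g = N → f ≠ 0 → a ≠ 0 →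
    f * a = g * b → IsSingle g → deg g ≤ deg f → Reduces f g a b := by
  induction N using Nat.strong_induction_on with
  | _ N ih =>
  intro f g a b hN hf ha h hg hd
  have hg0 := hg.ne_zero
  have hb : b ≠ 0 := by
    rintro rfl
    rw [mul_zero] at h
    exact (mul_ne_zero hf ha) h
  obtain ⟨q, hq, hq'⟩ := exists_quotient_step h hf ha hg hd
  by_cases h0 : f + g * q = 0
  · have e := eq_of_add_eq_zero h0
    have hb' : b = q * a := by
      rw [e, mul_assoc] at h
      exact (mul_left_cancel₀ hg0 h).symm
    exact ⟨g, q, 1, 1, q, a, e, (mul_one g).symm, (one_mul a).symm, hb', by simp, rfl, rfl, rfl,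
      rfl⟩
  · have hlt := (add_eq_zero_or_deg_add_lt hf hq').resolve_left h0
    set f₁ := f + g * q with hf₁
    have hrel : f₁ * a = g * (b + q * a) := by
      rw [hf₁, add_mul, h, mul_add, mul_assoc]
    have hb₁ : b + q * a ≠ 0 := by
      intro e
      rw [e, mul_zero] at hrel
      exact (mul_ne_zero h0 ha) hrel
    have key : Reduces f₁ g a (b + q * a) := by
      rcases le_total (deg g) (deg f₁) with h1 | h1
      · exact ih _ (by omega) f₁ g a _ rfl h0 ha hrel hg h1
      · exact (ih _ (by omega) g f₁ (b + q * a) a rfl hg0 hb₁ hrel.symm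
          (isSingle_of_mul_eq_mul hrel.symm hb₁ ha h1 hg) h1).symm
    obtain ⟨c, f', g', a', b', m, h1, h2, h3, h4, h5, h6, h7, -, h9⟩ := key
    have e1 : f = c * (f' + g' * q) := by
      rw [mul_add, ← h1, ← mul_assoc, ← h2, hf₁, add_add_self]
    have e2 : b = (b' + q * a') * m := by
      rw [add_mul, ← h4, mul_assoc, ← h3, add_add_self]
    have e3 : (f' + g' * q) * a' = g' * (b' + q * a') := by
      rw [add_mul, h5, mul_add, mul_assoc]
    refine ⟨c, f' + g' * q, g', a', b' + q * a', m, e1, h2, h3, e2, e3, ?_, h7, ?_, h9⟩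
    · rw [map_add, map_add, map_mul, map_mul, h6, h7, mul_comm]
    · have n1 : f' + g' * q ≠ 0 := by
        intro e
        rw [e, mul_zero] at e1
        exact hf e1
      have n2 : a' ≠ 0 := by
        intro e
        rw [e, zero_mul] at h3
        exact ha h3
      have n3 : g' ≠ 0 := by
        intro e
        rw [e, mul_zero] at h2
        exact hg0 h2
      have n4 : b' + q * a' ≠ 0 := by
        intro e
        rw [e, zero_mul] at e2
        exact hb e2
      have := congrArg deg e3
      rw [deg_mul n1 n2, deg_mul n3 n4] at this
      omega

/-- The Euclidean algorithm in the free algebra, for a common right multiple of two elements with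
a single top word. -/
theorem reduces {f g a b : FA k} (hf : IsSingle f) (hg : IsSingle g) (ha : a ≠ 0)
    (h : f * a = g * b) : Reduces f g a b := by
  rcases le_total (deg g) (deg f) with hd | hd
  · exact reduces_aux _ f g a b rfl hf.ne_zero ha h hg hd
  · refine (reduces_aux _ g f b a rfl hg.ne_zero ?_ h.symm hf hd).symm
    rintro rfl
    rw [mul_zero] at h
    exact (mul_ne_zero hf.ne_zero ha) h

/-- If `s x` and `x` have a common right multiple then `x` is a left factor of `s x`. The Euclidean
algorithm yields `s = h s'`, `x = h x'` and `s' g = x' l` where `g` is a left factor of a multiple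
of `x` and `g` and `x'` are indistinguishable in `GF₂[X]`. Dividing `x` by `g`, the image of the
remainder in `GF₂[X]` is a multiple of the image of `g` of too small a degree. So `g` is a left
factor of `x`. -/
theorem exists_conjugate {s x A B : FA k} (hs : IsSingle s) (hx : IsSingle x) (hA : A ≠ 0)
    (h : s * x * A = x * B) : ∃ t, s * x = x * t := by
  have hx0 := hx.ne_zero
  have hxA : x * A ≠ 0 := mul_ne_zero hx0 hA
  rw [mul_assoc] at h
  obtain ⟨c, s', x', g, l, m, h1, h2, h3, -, h5, -, h7, -, h9⟩ := reduces hs hx hxA h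
  have hm : m ≠ 0 := by
    rintro rfl
    exact hxA (by rw [h3, mul_zero])
  have hx' : IsSingle x' := by
    rw [h2] at hx
    exact hx.of_mul_right
  have hc : c ≠ 0 := by
    rintro rfl
    exact hx0 (by rw [h2, zero_mul])
  have hd : deg g ≤ deg x := by
    rw [← h9, h2, deg_mul hc hx'.ne_zero]
    omega
  have hg : IsSingle g := isSingle_of_mul_eq_mul h3 hA hm hd hx
  obtain ⟨q, r, e, hr⟩ := exists_division hg hA x m h3
  have hr0 : r = 0 := by
    by_contra hr0
    have hlt := hr.resolve_left hr0
    have hrel : r * A = g * (m + q * A) := by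
      have : r = x + g * q := by rw [e, add_comm (g * q), add_add_self]
      rw [this, add_mul, h3, mul_add, mul_assoc]
    have hn : m + q * A ≠ 0 := by
      intro e'
      rw [e', mul_zero] at hrel
      exact (mul_ne_zero hr0 hA) hrel
    have hrs : IsSingle r := isSingle_of_mul_eq_mul hrel.symm hn hA hlt.le hg
    have hdvd : collapse k x' ∣ collapse k r := by
      have h10 : collapse k r = collapse k x + collapse k g * collapse k q := by
        rw [← map_mul, ← map_add, e, add_comm (g * q), add_add_self]
      rw [h10, h2, map_mul, ← h7]
      exact dvd_add (dvd_mul_left _ _) (dvd_mul_right _ _)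
    have := Polynomial.natDegree_le_of_dvd hdvd hrs.collapse_ne_zero
    rw [hx'.natDegree_collapse, hrs.natDegree_collapse, h9] at this
    omega
  rw [hr0, add_zero] at e
  refine ⟨l * q, ?_⟩
  calc s * x = c * (s' * g) * q := by rw [h1]; nth_rw 1 [e]; simp only [mul_assoc]
    _ = x * (l * q) := by rw [h5, h2]; simp only [mul_assoc]

end FA

/-! ### Squares, periods, and the first distinct coefficients -/

namespace Words

variable {α : Type*}

theorem SquareFree.infix {v w : List α} (hw : SquareFree w) (h : v <:+: w) : SquareFree v :=
  fun β hβ h' => hw β hβ (h'.trans h)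

theorem SquareFree.reverse {w : List α} (h : Words.SquareFree w) :
    Words.SquareFree w.reverse := by
  intro β hβ h'
  refine h β.reverse (by simpa using hβ) ?_
  rw [← List.reverse_infix] at h'
  simpa using h'

/-- If `X` is a prefix of `S S S ⋯` then every nonempty prefix of `X`, followed by `S`, contains a
square. -/
theorem not_squareFree_prefix_append {S X : List α} (hS : S ≠ []) (hX : X <+: S ++ X)
    (hl : S.length ≤ X.length) (P : List α) (hP : P ≠ []) (hPX : P <+: X) :
    ¬ SquareFree (P ++ S) := by
  induction hn : P.length using Nat.strong_induction_on generalizing P with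
  | _ n ih =>
  subst hn
  have hSX : S <+: X :=
    List.prefix_of_prefix_length_le (List.prefix_append S X) hX hl
  rcases le_total P.length S.length with h | h
  · obtain ⟨z, rfl⟩ := List.prefix_of_prefix_length_le hPX hSX h
    intro hs
    exact hs P hP ⟨[], z, by simp⟩
  · obtain ⟨P', rfl⟩ := List.prefix_of_prefix_length_le hSX hPX h
    by_cases hP' : P' = []
    · subst hP'
      intro hs
      exact hs S hS ⟨[], [], by simp⟩
    · have h1 : P' <+: X := by
        have := hPX.trans hX
        rwa [List.prefix_append_right_inj] at this
      have hlt : P'.length < (S ++ P').length := by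
        rw [List.length_append]
        have := List.length_pos_of_ne_nil hS
        omega
      intro hs
      refine ih _ hlt P' hP' h1 rfl (hs.infix ⟨S, [], ?_⟩)
      simp

theorem not_squareFree_of_hasPeriod {F : List α} {g : ℕ} (hg : 0 < g) (hp : F.HasPeriod g)
    (hl : 2 * g ≤ F.length) : ¬ SquareFree F := by
  have h1 : F.drop g <+: F := hp.drop_prefix
  have h2 : F.take g <+: F.drop g :=
    List.prefix_of_prefix_length_le (List.take_prefix g F) h1 (by
      rw [List.length_take, List.length_drop]; omega)
  obtain ⟨z, hz⟩ := h2
  intro hs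
  refine hs (F.take g) ?_ ⟨[], z, ?_⟩
  · intro h
    have := congrArg List.length h
    rw [List.length_take, List.length_nil] at this
    omega
  · rw [List.nil_append, List.append_assoc, hz, List.take_append_drop]

/-- By the periodicity lemma, the length of a square-free factor of a long word divides every small
period of the word as soon as it is a period itself. -/
theorem dvd_of_hasPeriod {X F : List α} {q : ℕ} (hF : SquareFree F) (hF0 : F ≠ [])
    (hFX : F <:+: X) (h1 : X.HasPeriod F.length) (h2 : X.HasPeriod q)
    (hl : q + F.length ≤ X.length) : F.length ∣ q := by
  have hpos := List.length_pos_of_ne_nil hF0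
  have hg := List.HasPeriod.gcd h2 h1 (by omega)
  have hgp : 0 < q.gcd F.length := Nat.gcd_pos_of_pos_right _ hpos
  have hdvd : q.gcd F.length ∣ F.length := Nat.gcd_dvd_right _ _
  by_contra hn
  have hne : q.gcd F.length ≠ F.length := fun h => hn (h ▸ Nat.gcd_dvd_left _ _)
  refine not_squareFree_of_hasPeriod hgp (hg.infix hFX) ?_ hF
  obtain ⟨c, hc⟩ := hdvd
  have : c ≠ 0 := by rintro rfl; omega
  have : c ≠ 1 := by rintro rfl; omega
  have : 2 ≤ c := by omega
  calc 2 * q.gcd F.length ≤ c * q.gcd F.length := Nat.mul_le_mul_right _ this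
    _ = F.length := by rw [mul_comm]; exact hc.symm

theorem hasPeriod_of_prefix {X Q : List α} (h : X <+: Q ++ X) : X.HasPeriod Q.length := by
  rcases le_total X.length Q.length with hl | hl
  · exact List.hasPeriod_of_length_le _ _ hl
  · have : Q <+: X := List.prefix_of_prefix_length_le (List.prefix_append Q X) h hl
    have : X.take Q.length = Q := by
      obtain ⟨z, rfl⟩ := this
      simp
    rw [List.HasPeriod, this]
    exact h

theorem prefix_of_append_eq {X Q A B : List α} (h : X ++ A = Q ++ X ++ B) : X <+: Q ++ X := by
  refine List.prefix_of_prefix_length_le (l₃ := X ++ A) (List.prefix_append _ _) ?_ ?_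
  · rw [h]
    exact List.prefix_append _ _
  · simp

end Words

namespace FA

variable {k : ℕ}

/-- The top homogeneous part of `f` is a single word, and that word is square-free. -/
def IsSqFree (f : FA k) : Prop := ∃ w, topWords f = {w} ∧ Words.SquareFree w

theorem IsSqFree.isSingle {f : FA k} (h : IsSqFree f) : IsSingle f := by
  obtain ⟨w, hw, -⟩ := h
  exact ⟨w, hw⟩

theorem IsSqFree.ne_zero {f : FA k} (h : IsSqFree f) : f ≠ 0 := h.isSingle.ne_zero

/-- If the top parts of `s x a` and `x b` agree then the top words of `x` are prefixes of
`S S S ⋯` where `S` is the top word of `s`; in particular there is only one of them. -/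
theorem isSingle_of_topWords_eq {s x a b : FA k} {S : List (Fin k)} (hS : topWords s = {S})
    (hS0 : S ≠ []) (hx : x ≠ 0) (ha : a ≠ 0)
    (h : topWords (s * x * a) = topWords (x * b)) :
    ∃ X, topWords x = {X} ∧ X <+: S ++ X := by
  have hs : s ≠ 0 := ne_zero_of_mem (w := S) (by simp [hS])
  have hb : b ≠ 0 := by
    rintro rfl
    obtain ⟨w, hw⟩ := topWords_nonempty (mul_ne_zero (mul_ne_zero hs hx) ha)
    rw [h, mul_zero] at hw
    exact ne_zero_of_mem hw rfl
  have key : ∀ w ∈ topWords x, ∃ w' ∈ topWords x, w <+: S ++ w' := by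
    intro w hw
    obtain ⟨v, hv⟩ := topWords_nonempty hb
    have := append_mem_topWords_mul hw hv
    rw [← h, mem_topWords_mul (mul_ne_zero hs hx) ha] at this
    obtain ⟨u, hu, z, -, e⟩ := this
    rw [mem_topWords_mul hs hx] at hu
    obtain ⟨S', hS', w', hw', rfl⟩ := hu
    rw [hS, Finset.mem_singleton] at hS'
    subst hS'
    refine ⟨w', hw', List.prefix_of_prefix_length_le (l₃ := w ++ v) (List.prefix_append _ _) ?_ ?_⟩
    · rw [e]
      exact List.prefix_append _ _
    · rw [List.length_append, length_of_mem_topWords hw, length_of_mem_topWords hw']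
      omega
  have htake : ∀ j, ∀ u ∈ topWords x, ∀ v ∈ topWords x, u.take j = v.take j := by
    intro j
    induction j using Nat.strong_induction_on with
    | _ j ih =>
    intro u hu v hv
    obtain ⟨u', hu', h1⟩ := key u hu
    obtain ⟨v', hv', h2⟩ := key v hv
    have hlen : u.length = v.length := by
      rw [length_of_mem_topWords hu, length_of_mem_topWords hv]
    rw [List.prefix_iff_eq_take] at h1 h2
    rw [h1, h2, List.take_take, List.take_take, hlen]
    rcases Nat.eq_zero_or_pos j with rfl | hj
    · simp
    rw [List.take_append, List.take_append]
    congr 1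
    rcases Nat.eq_zero_or_pos (min j v.length) with h0 | h0
    · simp [h0]
    · apply ih _ _ u' hu' v' hv'
      have := List.length_pos_of_ne_nil hS0
      omega
  have hsing : IsSingle x := by
    rw [isSingle_iff]
    refine ⟨hx, fun u hu v hv => ?_⟩
    have := htake (deg x) u hu v hv
    rwa [List.take_of_length_le (length_of_mem_topWords hu).le,
      List.take_of_length_le (length_of_mem_topWords hv).le] at this
  obtain ⟨X, hX⟩ := hsing
  refine ⟨X, hX, ?_⟩
  obtain ⟨w', hw', hp⟩ := key X (by simp [hX])
  rw [hX, Finset.mem_singleton] at hw'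
  rwa [hw'] at hp

/-- If `a x A = b x B` with `a` of larger degree than `b`, then `b` is a left factor of `a`. The
remainder of the division would produce a square in the top word of `a`. -/
theorem exists_left_quotient {a b x A B : FA k} (ha : IsSqFree a) (hb : IsSingle b)
    (hx : x ≠ 0) (hA : A ≠ 0) (hdeg : deg b < deg a) (hdx : deg a ≤ deg x)
    (h : a * x * A = b * x * B) : ∃ s, IsSqFree s ∧ 1 ≤ deg s ∧ a = b * s := by
  have hB : B ≠ 0 := by
    rintro rfl
    rw [mul_zero] at h
    exact (mul_ne_zero (mul_ne_zero ha.ne_zero hx) hA) h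
  have hxA := mul_ne_zero hx hA
  have hxB := mul_ne_zero hx hB
  rw [mul_assoc, mul_assoc] at h
  obtain ⟨s, r, e, hr⟩ := exists_division hb hxA a _ h
  have hb0 := hb.ne_zero
  have hs0 : s ≠ 0 := by
    rintro rfl
    rw [mul_zero, zero_add] at e
    subst e
    rcases hr with hr | hr
    · exact ha.ne_zero hr
    · omega
  have hbs : b * s ≠ 0 := mul_ne_zero hb0 hs0
  have htop : topWords a = topWords (b * s) := by
    rw [e]
    refine topWords_add_of_lt (hr.imp_right fun h' => ?_)
    rw [deg_mul hb0 hs0]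
    omega
  obtain ⟨a₀, ha₀, hsq⟩ := ha
  obtain ⟨b₀, hb₀⟩ := hb
  have hsS : IsSingle s := IsSingle.of_mul_right (f := b) ⟨a₀, by rw [← htop, ha₀]⟩
  obtain ⟨S, hS⟩ := hsS
  have ha₀' : a₀ = b₀ ++ S := by
    rw [topWords_mul_single hb₀ hS, ha₀] at htop
    simpa using htop
  have hlS : S.length = deg s := length_of_mem_topWords (by simp [hS])
  have hla : a₀.length = deg a := length_of_mem_topWords (by simp [ha₀])
  have hlb : b₀.length = deg b := length_of_mem_topWords (by simp [hb₀])
  have hlen := congrArg List.length ha₀'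
  rw [List.length_append] at hlen
  refine ⟨s, ⟨S, hS, hsq.infix ⟨b₀, [], by simp [ha₀']⟩⟩, by omega, ?_⟩
  by_contra hne
  have hr0 : r ≠ 0 := by
    rintro rfl
    rw [add_zero] at e
    exact hne e
  replace hr := hr.resolve_left hr0
  have hrel : r * (x * A) = b * (x * B + s * (x * A)) := by
    have : r = a + b * s := by rw [e, add_comm (b * s), add_add_self]
    rw [this, add_mul, h, mul_add, mul_assoc]
  have hY : x * B + s * (x * A) ≠ 0 := by
    intro e'
    rw [e', mul_zero] at hrel
    exact (mul_ne_zero hr0 hxA) hrel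
  have hdY := congrArg deg hrel
  rw [deg_mul hr0 hxA, deg_mul hb0 hY] at hdY
  have htop' : topWords (s * x * A) = topWords (x * B) := by
    rw [mul_assoc]
    refine (topWords_eq_of_deg_add_lt (Or.inr ?_)).symm
    rw [add_comm, deg_mul hs0 hxA]
    omega
  have hS0 : S ≠ [] := by
    rintro rfl
    rw [List.length_nil] at hlen
    omega
  obtain ⟨X, hX, hXp⟩ := isSingle_of_topWords_eq hS hS0 hx hA htop'
  have hlX : X.length = deg x := length_of_mem_topWords (by simp [hX])
  obtain ⟨r₀, hr₀⟩ := topWords_nonempty hr0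
  obtain ⟨z, hz⟩ := topWords_nonempty hA
  have hmem := append_mem_topWords_mul hr₀
    (append_mem_topWords_mul (show X ∈ topWords x by simp [hX]) hz)
  rw [hrel, mem_topWords_mul hb0 hY] at hmem
  obtain ⟨b₁, hb₁, y, -, e₁⟩ := hmem
  rw [hb₀, Finset.mem_singleton] at hb₁
  subst hb₁
  have hlr := length_of_mem_topWords hr₀
  obtain ⟨P, rfl⟩ : r₀ <+: b₁ := by
    refine List.prefix_of_prefix_length_le (l₃ := b₁ ++ y) ?_ (List.prefix_append _ _) (by omega)
    rw [← e₁]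
    exact List.prefix_append _ _
  rw [List.length_append] at hlb hlen
  rw [List.append_assoc, List.append_cancel_left_eq] at e₁
  have hPX : P <+: X := by
    refine List.prefix_of_prefix_length_le (l₃ := X ++ z) ?_ (List.prefix_append _ _) (by omega)
    rw [e₁]
    exact List.prefix_append _ _
  refine Words.not_squareFree_prefix_append hS0 hXp (by omega) P ?_ hPX
    (hsq.infix ⟨r₀, [], by simp [ha₀']⟩)
  rintro rfl
  simp at hlb
  omega

/-- The shapes of the first pair of distinct coefficients of the two sides of the equation: one of
the two is `p s`, and the other one is `p` or `p (s + 1)`. -/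
def Splits (a b s : FA k) : Prop :=
  ∃ p, p ≠ 0 ∧ ((a = p * s ∧ b = p) ∨ (a = p ∧ b = p * s) ∨ (a = p * (s + 1) ∧ b = p * s))

/-- Distinct coefficients `a`, `b` with `a x A = b x B` arise from each other, or both from `a + b`,
by multiplication with an element `s` or `s + 1`. -/
theorem exists_splits {a b x A B : FA k} (ha : IsSqFree a) (hb : IsSqFree b) (hab : a ≠ b)
    (hx : x ≠ 0) (hA : A ≠ 0) (hdx : max (deg a) (deg b) ≤ deg x)
    (h : a * x * A = b * x * B) : ∃ s, IsSqFree s ∧ 1 ≤ deg s ∧ Splits a b s := by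
  have hB : B ≠ 0 := by
    rintro rfl
    rw [mul_zero] at h
    exact (mul_ne_zero (mul_ne_zero ha.ne_zero hx) hA) h
  rw [max_le_iff] at hdx
  rcases lt_trichotomy (deg a) (deg b) with hd | hd | hd
  · obtain ⟨s, h1, h2, h3⟩ := exists_left_quotient hb ha.isSingle hx hB hd hdx.2 h.symm
    exact ⟨s, h1, h2, a, ha.ne_zero, Or.inr (Or.inl ⟨rfl, h3⟩)⟩
  · -- The difference `r = a + b` has smaller degree, and `b x (A + B) = r x A`.
    have hr0 : a + b ≠ 0 := fun e => hab (eq_of_add_eq_zero e)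
    have hrel : b * x * (A + B) = (a + b) * x * A := by
      rw [mul_add, ← h, add_mul, add_mul, add_comm]
    have hAB : A + B ≠ 0 := by
      intro e
      rw [e, mul_zero] at hrel
      exact (mul_ne_zero (mul_ne_zero hr0 hx) hA) hrel.symm
    have htop : topWords a = topWords b := by
      obtain ⟨a₀, ha₀, -⟩ := id ha
      obtain ⟨b₀, hb₀, -⟩ := id hb
      have h' := h
      rw [mul_assoc, mul_assoc] at h'
      obtain ⟨v, hv, hp⟩ := prefix_of_mul_eq_mul h' (mul_ne_zero hx hA) (mul_ne_zero hx hB) hd.ge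
        (show a₀ ∈ topWords a by simp [ha₀])
      rw [hb₀, Finset.mem_singleton] at hv
      rw [ha₀, hb₀, ← hv, hp.eq_of_length]
      rw [length_of_mem_topWords (show a₀ ∈ topWords a by simp [ha₀]), hd]
      exact length_of_mem_topWords (by simp [hv, hb₀])
    have hlt := (add_eq_zero_or_deg_add_lt ha.ne_zero htop).resolve_left hr0
    rw [hd] at hlt
    have hrs : IsSingle (a + b) := by
      have h' := hrel
      rw [mul_assoc, mul_assoc] at h'
      exact isSingle_of_mul_eq_mul h' (mul_ne_zero hx hAB) (mul_ne_zero hx hA) hlt.le hb.isSingle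
    obtain ⟨s, h1, h2, h3⟩ := exists_left_quotient hb hrs hx hAB hlt hdx.2 hrel
    refine ⟨s, h1, h2, a + b, hr0, Or.inr (Or.inr ⟨?_, h3⟩)⟩
    rw [mul_add, ← h3, mul_one, add_comm b, add_add_self]
  · obtain ⟨s, h1, h2, h3⟩ := exists_left_quotient ha hb.isSingle hx hA hd hdx.1 h
    exact ⟨s, h1, h2, b, hb.ne_zero, Or.inl ⟨h3, rfl⟩⟩

/-- In each of the three cases `a y A = b y B` becomes `s y A' = y B'`, with `A'` one of `A`, `B` and
`A + B`. -/
theorem Splits.exists_conjugate {a b s y A B : FA k} (hs : IsSqFree s) (hs1 : 1 ≤ deg s)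
    (hsp : Splits a b s) (ha : a ≠ 0) (hab : a ≠ b) (hy : y ≠ 0) (hA : A ≠ 0)
    (h : a * y * A = b * y * B) : IsSingle y ∧ ∃ t, s * y = y * t := by
  have key : ∃ A' B' : FA k, A' ≠ 0 ∧ s * y * A' = y * B' := by
    obtain ⟨p, hp, ⟨rfl, rfl⟩ | ⟨rfl, rfl⟩ | ⟨h1, h2⟩⟩ := hsp
    · refine ⟨A, B, hA, mul_left_cancel₀ hp ?_⟩
      simpa only [mul_assoc] using h
    · refine ⟨B, A, ?_, mul_left_cancel₀ hp ?_⟩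
      · rintro rfl
        rw [mul_zero] at h
        exact (mul_ne_zero (mul_ne_zero ha hy) hA) h
      · simpa only [mul_assoc] using h.symm
    · have hrel : b * y * (A + B) = (a + b) * y * A := by
        rw [mul_add, ← h, add_mul, add_mul, add_comm]
      have hr0 : a + b ≠ 0 := fun e => hab (eq_of_add_eq_zero e)
      have hsum : a + b = p := by
        rw [h1, h2, mul_add, mul_one, add_comm (p * s), add_add_self]
      refine ⟨A + B, A, ?_, mul_left_cancel₀ hp ?_⟩
      · intro e
        rw [e, mul_zero] at hrel
        exact (mul_ne_zero (mul_ne_zero hr0 hy) hA) hrel.symm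
      · rw [hsum, h2] at hrel
        simpa only [mul_assoc] using hrel
  obtain ⟨A', B', hA', e⟩ := key
  obtain ⟨S, hS, -⟩ := id hs
  have hS0 : S ≠ [] := by
    rintro rfl
    have : ([] : List (Fin k)).length = deg s := length_of_mem_topWords (by simp [hS])
    rw [List.length_nil] at this
    omega
  obtain ⟨X, hX, -⟩ := isSingle_of_topWords_eq hS hS0 hy hA' (by rw [e])
  exact ⟨⟨X, hX⟩, FA.exists_conjugate hs.isSingle ⟨X, hX⟩ hA' e⟩

end FA

/-! ### The two sides of the equation and their reversal -/

namespace FA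

variable {k : ℕ}

/-- The element `u₁ x u₂ x ⋯ x uₙ` for a list of coefficients. -/
noncomputable def interleave (x : FA k) (l : List (FA k)) : FA k := (l.intersperse x).prod

@[simp] theorem interleave_singleton (x a : FA k) : interleave x [a] = a := by
  simp [interleave]

theorem interleave_cons (x a : FA k) {l : List (FA k)} (hl : l ≠ []) :
    interleave x (a :: l) = a * x * interleave x l := by
  cases l with
  | nil => exact absurd rfl hl
  | cons b l => simp [interleave, mul_assoc]

theorem interleave_append (x a : FA k) (p l : List (FA k)) :
    interleave x (p ++ a :: l) = (p.map (· * x)).prod * interleave x (a :: l) := by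
  induction p with
  | nil => simp
  | cons b p ih =>
    rw [List.cons_append, interleave_cons _ _ (by simp), ih, List.map_cons, List.prod_cons]
    simp only [mul_assoc]

theorem interleave_concat (x b : FA k) {l : List (FA k)} (hl : l ≠ []) :
    interleave x (l ++ [b]) = interleave x l * x * b := by
  induction l with
  | nil => exact absurd rfl hl
  | cons a l ih =>
    by_cases h : l = []
    · subst h
      rw [List.singleton_append, interleave_cons _ _ (by simp)]
      simp
    · rw [List.cons_append, interleave_cons _ _ (by simp), ih h, interleave_cons _ _ h]
      simp only [mul_assoc]

theorem star_interleave (x : FA k) (l : List (FA k)) :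
    star (interleave x l) = interleave (star x) (l.map star).reverse := by
  induction l with
  | nil => simp [interleave]
  | cons a l ih =>
    by_cases h : l = []
    · subst h
      simp
    · rw [interleave_cons _ _ h, List.map_cons, List.reverse_cons, interleave_concat _ _ (by simpa),
        star_mul, star_mul, ih, mul_assoc]

theorem interleave_ne_zero {x : FA k} (hx : x ≠ 0) {l : List (FA k)} (hl : ∀ a ∈ l, a ≠ 0) :
    interleave x l ≠ 0 := by
  induction l with
  | nil => simp [interleave]
  | cons a l ih =>
    have h1 := hl a (by simp)
    have h2 := ih fun b hb => hl b (by simp [hb])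
    by_cases h : l = []
    · subst h
      simpa using h1
    · rw [interleave_cons _ _ h]
      exact mul_ne_zero (mul_ne_zero h1 hx) h2

theorem deg_interleave {x : FA k} (hx : x ≠ 0) {l : List (FA k)} (hl : ∀ a ∈ l, a ≠ 0) :
    deg (interleave x l) = (l.map deg).sum + (l.length - 1) * deg x := by
  induction l with
  | nil => simp [interleave]
  | cons a l ih =>
    have h1 := hl a (by simp)
    have hl' : ∀ b ∈ l, b ≠ 0 := fun b hb => hl b (by simp [hb])
    have h2 := ih hl'
    by_cases h : l = []
    · subst h
      simp
    · rw [interleave_cons _ _ h, deg_mul (mul_ne_zero h1 hx) (interleave_ne_zero hx hl'),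
        deg_mul h1 hx, h2]
      obtain ⟨m, hm⟩ : ∃ m, l.length = m + 1 := ⟨l.length - 1, by
        have := List.length_pos_of_ne_nil h
        omega⟩
      simp only [List.map_cons, List.sum_cons, List.length_cons, hm, Nat.add_sub_cancel]
      ring

theorem sum_deg_eq {x : FA k} (hx : x ≠ 0) {l l' : List (FA k)} (hl : ∀ a ∈ l, a ≠ 0)
    (hl' : ∀ a ∈ l', a ≠ 0) (hlen : l.length = l'.length) (h : interleave x l = interleave x l') :
    (l.map deg).sum = (l'.map deg).sum := by
  have := congrArg deg h
  rw [deg_interleave hx hl, deg_interleave hx hl', hlen] at this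
  omega

theorem exists_first_difference {β : Type*} {l l' : List β} (hlen : l.length = l'.length)
    (hne : l ≠ l') : ∃ p a b m m', l = p ++ a :: m ∧ l' = p ++ b :: m' ∧ a ≠ b ∧
      m.length = m'.length := by
  induction l generalizing l' with
  | nil =>
    cases l' with
    | nil => exact absurd rfl hne
    | cons b l' => simp at hlen
  | cons a l ih =>
    cases l' with
    | nil => simp at hlen
    | cons b l' =>
      by_cases hab : a = b
      · subst hab
        obtain ⟨p, c, d, m, m', rfl, rfl, h1, h2⟩ := ih (by simpa using hlen)
          (fun h => hne (by rw [h]))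
        exact ⟨a :: p, c, d, m, m', rfl, rfl, h1, h2⟩
      · exact ⟨[], a, b, l, l', rfl, rfl, hab, by simpa using hlen⟩

theorem deg_add_one {s : FA k} (hs : 1 ≤ deg s) : deg (s + 1) = deg s := by
  have hs0 : s ≠ 0 := by
    rintro rfl
    simp at hs
  exact (deg_eq_of_topWords_eq hs0 (topWords_add_of_lt (Or.inr (by rw [deg_one]; omega))).symm).symm

/-- The first pair of distinct coefficients determines an element `s` such that `y` is a left factor
of `s y` for all nonzero solutions `y` of the equation. -/
theorem exists_left_multiplier {l l' : List (FA k)} (hlen : l.length = l'.length) (hne : l ≠ l')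
    (hl : ∀ a ∈ l, IsSqFree a) (hl' : ∀ a ∈ l', IsSqFree a) {x : FA k} (hx0 : x ≠ 0)
    (hx : interleave x l = interleave x l') (hdeg : (l.map deg).sum ≤ deg x) :
    ∃ s, IsSqFree s ∧ 1 ≤ deg s ∧ deg s ≤ (l.map deg).sum ∧
      ((∃ a ∈ l, deg s ≤ deg a) ∨ l.map deg ≠ l'.map deg) ∧
      ∀ y, y ≠ 0 → interleave y l = interleave y l' → IsSingle y ∧ ∃ t, s * y = y * t := by
  have hsum := sum_deg_eq hx0 (fun a ha => (hl a ha).ne_zero) (fun a ha => (hl' a ha).ne_zero)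
    hlen hx
  obtain ⟨p, a, b, m, m', rfl, rfl, hab, hm⟩ := exists_first_difference hlen hne
  have ha := hl a (by simp)
  have hb := hl' b (by simp)
  have hp : ∀ c ∈ p, c ≠ 0 := fun c hc => (hl c (by simp [hc])).ne_zero
  have hm0 : ∀ c ∈ m, c ≠ 0 := fun c hc => (hl c (by simp [hc])).ne_zero
  have key : ∀ y, y ≠ 0 → interleave y (p ++ a :: m) = interleave y (p ++ b :: m') →
      a * y * interleave y m = b * y * interleave y m' := by
    intro y hy h
    have hpy : (p.map (· * y)).prod ≠ 0 := by
      rw [Ne, List.prod_eq_zero_iff, List.mem_map]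
      rintro ⟨c, hc, e⟩
      exact mul_ne_zero (hp c hc) hy e
    rw [interleave_append, interleave_append] at h
    replace h := mul_left_cancel₀ hpy h
    by_cases hm1 : m = []
    · subst hm1
      have hm2 : m' = [] := List.length_eq_zero_iff.1 (by simpa using hm.symm)
      subst hm2
      simp only [interleave_singleton] at h
      exact absurd h hab
    · have hm2 : m' ≠ [] := by
        rintro rfl
        exact hm1 (List.length_eq_zero_iff.1 (by simpa using hm))
      rwa [interleave_cons _ _ hm1, interleave_cons _ _ hm2] at h
  have hda : deg a ≤ ((p ++ a :: m).map deg).sum := by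
    simp only [List.map_append, List.map_cons, List.sum_append, List.sum_cons]
    omega
  have hdb : deg b ≤ ((p ++ a :: m).map deg).sum := by
    rw [hsum]
    simp only [List.map_append, List.map_cons, List.sum_append, List.sum_cons]
    omega
  obtain ⟨s, hs, hs1, hsp⟩ := exists_splits ha hb hab hx0 (interleave_ne_zero hx0 hm0)
    (max_le (hda.trans hdeg) (hdb.trans hdeg)) (key x hx0 hx)
  have hbound : deg s ≤ deg a ∨ (deg s ≤ deg b ∧ deg a ≠ deg b) := by
    obtain ⟨c, hc, ⟨h1, h2⟩ | ⟨h1, h2⟩ | ⟨h1, h2⟩⟩ := hsp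
    · left
      rw [h1, deg_mul hc hs.ne_zero]
      omega
    · right
      rw [h1, h2, deg_mul hc hs.ne_zero]
      omega
    · left
      have h0 : s + 1 ≠ 0 := by
        intro e
        rw [e, mul_zero] at h1
        exact ha.ne_zero h1
      rw [h1, deg_mul hc h0, deg_add_one hs1]
      omega
  refine ⟨s, hs, hs1, ?_, ?_, fun y hy h => ?_⟩
  · rcases hbound with h | h
    · exact h.trans hda
    · exact h.1.trans hdb
  · rcases hbound with h | h
    · exact Or.inl ⟨a, by simp, h⟩
    · right
      simp [h.2]
  · exact hsp.exists_conjugate hs hs1 ha.ne_zero hab hy (interleave_ne_zero hy hm0) (key y hy h)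

theorem star_mon (w : List (Fin k)) : star (mon w) = mon w.reverse := by
  induction w with
  | nil => simp
  | cons a w ih =>
    have : mon (a :: w) = FreeAlgebra.ι (ZMod 2) a * mon w := by simp [mon]
    rw [this, star_mul, ih, FreeAlgebra.star_ι, List.reverse_cons, mon_append]
    simp [mon]

theorem words_star (f : FA k) : words (star f) = (words f).image List.reverse := by
  have : star f = poly ((words f).image List.reverse) := by
    conv_lhs => rw [← poly_words f]
    rw [poly, poly, star_sum, Finset.sum_image (fun a _ b _ h => List.reverse_injective h)]
    exact Finset.sum_congr rfl fun w _ => star_mon w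
  rw [this, words_poly]

@[simp] theorem deg_star (f : FA k) : deg (star f) = deg f := by
  have h : ∀ g : FA k, deg (star g) ≤ deg g := fun g => by
    apply deg_le
    intro w hw
    rw [words_star, Finset.mem_image] at hw
    obtain ⟨v, hv, rfl⟩ := hw
    rw [List.length_reverse]
    exact length_le_deg hv
  apply le_antisymm (h f)
  have := h (star f)
  rwa [star_star] at this

theorem topWords_star (f : FA k) : topWords (star f) = (topWords f).image List.reverse := by
  ext w
  simp only [mem_topWords, words_star, Finset.mem_image, deg_star]
  constructor
  · rintro ⟨⟨v, hv, rfl⟩, h⟩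
    exact ⟨v, ⟨hv, by rwa [List.length_reverse] at h⟩, rfl⟩
  · rintro ⟨v, ⟨hv, h⟩, rfl⟩
    exact ⟨⟨v, hv, rfl⟩, by rwa [List.length_reverse]⟩

theorem IsSqFree.star {f : FA k} (h : IsSqFree f) : IsSqFree (star f) := by
  obtain ⟨w, hw, hs⟩ := h
  exact ⟨w.reverse, by rw [topWords_star, hw, Finset.image_singleton], hs.reverse⟩

/-- The mirror image of `exists_left_multiplier`. -/
theorem exists_right_multiplier {l l' : List (FA k)} (hlen : l.length = l'.length) (hne : l ≠ l')
    (hl : ∀ a ∈ l, IsSqFree a) (hl' : ∀ a ∈ l', IsSqFree a) {x : FA k} (hx0 : x ≠ 0)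
    (hx : interleave x l = interleave x l') (hdeg : (l.map deg).sum ≤ deg x) :
    ∃ t, IsSqFree t ∧ 1 ≤ deg t ∧ deg t ≤ (l.map deg).sum ∧
      ∀ y, y ≠ 0 → interleave y l = interleave y l' → ∃ s, s * y = y * t := by
  have hrev : ∀ y, interleave y l = interleave y l' →
      interleave (star y) (l.map star).reverse = interleave (star y) (l'.map star).reverse := by
    intro y h
    rw [← star_interleave, h, star_interleave]
  have hsum : (((l.map star).reverse).map deg).sum = (l.map deg).sum := by
    rw [List.map_reverse, List.sum_reverse, List.map_map]
    congr 2
    funext a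
    simp
  have hne' : (l.map star).reverse ≠ (l'.map star).reverse := fun e =>
    hne (List.map_injective_iff.2 star_injective (List.reverse_injective e))
  have hstar : ∀ m : List (FA k), (∀ a ∈ m, IsSqFree a) →
      ∀ a ∈ (m.map star).reverse, IsSqFree a := by
    intro m hm a ha
    obtain ⟨b, hb, rfl⟩ : ∃ b ∈ m, star b = a := by simpa using ha
    exact (hm b hb).star
  obtain ⟨s, h1, h2, h3, -, h4⟩ := exists_left_multiplier (by simpa using hlen) hne'
    (hstar l hl) (hstar l' hl') (by simpa using hx0) (hrev x hx)
    (by rw [hsum, deg_star]; exact hdeg)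
  refine ⟨star s, h1.star, by simpa using h2, by rw [deg_star, ← hsum]; exact h3, ?_⟩
  intro y hy h
  obtain ⟨-, t, e⟩ := h4 (star y) (by simpa using hy) (hrev y h)
  refine ⟨star t, ?_⟩
  have := congrArg star e
  rw [star_mul, star_mul, star_star] at this
  exact this.symm

end FA

/-! ### Shifts of a periodic word -/

namespace Words

variable {α : Type*}

theorem exists_shift {w w' X z z' : List α} (h : w ++ X ++ z = w' ++ X ++ z')
    (hl : w.length ≤ w'.length) : ∃ Q, w' = w ++ Q ∧ X <+: Q ++ X := by
  obtain ⟨Q, rfl⟩ : w <+: w' := by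
    refine List.prefix_of_prefix_length_le (l₃ := w ++ X ++ z) ?_ ?_ hl
    · rw [List.append_assoc]
      exact List.prefix_append _ _
    · rw [h, List.append_assoc]
      exact List.prefix_append _ _
  refine ⟨Q, rfl, ?_⟩
  simp only [List.append_assoc, List.append_cancel_left_eq] at h
  exact prefix_of_append_eq (A := z) (B := z') (by rw [h, List.append_assoc])

theorem suffix_of_prefix {S X : List α} (hX : X <+: S ++ X) (hl : S.length ≤ X.length) (j : ℕ)
    {Q : List α} (hQ : Q <+: X) (hQl : Q.length = (j + 1) * S.length) : S <:+ Q := by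
  have hSX : S <+: X := List.prefix_of_prefix_length_le (List.prefix_append S X) hX hl
  induction j generalizing Q with
  | zero =>
    have : S <+: Q := List.prefix_of_prefix_length_le hSX hQ (by omega)
    rw [this.eq_of_length (by omega)]
  | succ j ih =>
    have hle : S.length ≤ Q.length := by
      rw [hQl]
      exact Nat.le_mul_of_pos_left _ (by omega)
    obtain ⟨Q', rfl⟩ := List.prefix_of_prefix_length_le hSX hQ hle
    have h1 : Q' <+: X := by
      have := hQ.trans hX
      rwa [List.prefix_append_right_inj] at this
    refine (ih h1 ?_).trans (List.suffix_append _ _)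
    rw [List.length_append] at hQl
    have : (j + 1 + 1) * S.length = S.length + (j + 1) * S.length := by ring
    omega

/-- Words without the suffix `S` are determined by the product with a long word `X` of period `S`:
any two positions of `X` differ by a multiple of the length of `S`. -/
theorem eq_of_append_eq {S X w w' z z' : List α} (hS : SquareFree S) (hS0 : S ≠ [])
    (hX : X <+: S ++ X) (hw : ¬ S <:+ w) (hw' : ¬ S <:+ w')
    (hl : w.length + S.length ≤ X.length) (hl' : w'.length + S.length ≤ X.length)
    (h : w ++ X ++ z = w' ++ X ++ z') : w = w' := by
  wlog hle : w.length ≤ w'.length generalizing w w' z z'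
  · exact (this hw' hw hl' hl h.symm (by omega)).symm
  obtain ⟨Q, rfl, hQ⟩ := exists_shift h hle
  by_cases hQ0 : Q = []
  · rw [hQ0, List.append_nil]
  exfalso
  rw [List.length_append] at hl'
  have hSX : S <+: X := List.prefix_of_prefix_length_le (List.prefix_append S X) hX (by omega)
  obtain ⟨c, hc⟩ := dvd_of_hasPeriod hS hS0 hSX.isInfix (hasPeriod_of_prefix hX)
    (hasPeriod_of_prefix hQ) (by omega)
  have hQX : Q <+: X := List.prefix_of_prefix_length_le (List.prefix_append Q X) hQ (by omega)
  have hpos := List.length_pos_of_ne_nil hQ0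
  cases c with
  | zero => omega
  | succ c =>
    exact hw' ((suffix_of_prefix hX (by omega) c hQX (by rw [hc, mul_comm])).trans
      (List.suffix_append _ _))

end Words

namespace FA

variable {k : ℕ}

theorem exists_rotation {a x b : FA k} {X : List (Fin k)} (hX : topWords x = {X})
    (h : a * x = x * b) {A : List (Fin k)} (hA : A ∈ topWords a) :
    ∃ B ∈ topWords b, A ++ X = X ++ B := by
  have hx : IsSingle x := ⟨X, hX⟩
  have hb : b ≠ 0 := by
    rintro rfl
    rw [mul_zero] at h
    exact mul_ne_zero (ne_zero_of_mem hA) hx.ne_zero h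
  have := append_mem_topWords_mul hA (show X ∈ topWords x by simp [hX])
  rw [h, mem_topWords_mul hx.ne_zero hb] at this
  obtain ⟨X', hX', B, hB, e⟩ := this
  rw [hX, Finset.mem_singleton] at hX'
  exact ⟨B, hB, by rw [e, hX']⟩

theorem deg_eq_of_mul_eq_mul {a x b : FA k} (hx : x ≠ 0) (ha : a ≠ 0)
    (h : a * x = x * b) : deg a = deg b := by
  have hb : b ≠ 0 := by
    rintro rfl
    rw [mul_zero] at h
    exact mul_ne_zero ha hx h
  have := congrArg deg h
  rw [deg_mul ha hx, deg_mul hx hb] at this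
  omega

/-- Two conjugations `s x = x t` and `s' x = x t'` by a long element `x` agree up to a constant:
otherwise the top word of `x` would have a period that is too small. -/
theorem eq_or_eq_add_one {s t s' t' x : FA k} (hs : IsSqFree s) (ht' : IsSqFree t')
    (hs1 : 1 ≤ deg s) (ht1 : 1 ≤ deg t') (hx : IsSingle x) (hd : deg s + deg t' ≤ deg x)
    (h : s * x = x * t) (h' : s' * x = x * t') : t = t' ∨ t = t' + 1 := by
  obtain ⟨X, hX⟩ := id hx
  obtain ⟨S, hS, hSq⟩ := id hs
  obtain ⟨T', hT', hTq⟩ := id ht'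
  have hx0 := hx.ne_zero
  have hs'0 : s' ≠ 0 := by
    rintro rfl
    rw [zero_mul] at h'
    exact mul_ne_zero hx0 ht'.ne_zero h'.symm
  have hlX : X.length = deg x := length_of_mem_topWords (by simp [hX])
  have hlS : S.length = deg s := length_of_mem_topWords (by simp [hS])
  have hlT' : T'.length = deg t' := length_of_mem_topWords (by simp [hT'])
  have hS0 : S ≠ [] := by
    rintro rfl
    rw [List.length_nil] at hlS
    omega
  have hT0 : T' ≠ [] := by
    rintro rfl
    rw [List.length_nil] at hlT'
    omega
  obtain ⟨T, hT, e⟩ := exists_rotation hX h (A := S) (by simp [hS])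
  obtain ⟨S', hS'⟩ := topWords_nonempty hs'0
  obtain ⟨T₁, hT₁, e'⟩ := exists_rotation hX h' hS'
  rw [hT', Finset.mem_singleton] at hT₁
  subst hT₁
  have hSX : X <+: S ++ X := by rw [e]; exact List.prefix_append _ _
  have hSX' : X <+: S' ++ X := by rw [e']; exact List.prefix_append _ _
  have hp := Words.hasPeriod_of_prefix hSX
  have hp' := Words.hasPeriod_of_prefix hSX'
  have hlS' : S'.length = T₁.length := by
    have := congrArg List.length e'
    rw [List.length_append, List.length_append] at this
    omega
  have hlST : S.length = T.length := by
    have := congrArg List.length e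
    rw [List.length_append, List.length_append] at this
    omega
  have hSpre : S <+: X :=
    List.prefix_of_prefix_length_le (List.prefix_append S X) hSX (by omega)
  have hTsuf : T₁ <:+ X := by
    refine List.suffix_of_suffix_length_le (l₃ := X ++ T₁) (List.suffix_append _ _) ?_ (by omega)
    rw [← e']
    exact List.suffix_append _ _
  have hTsuf' : T <:+ X := by
    refine List.suffix_of_suffix_length_le (l₃ := X ++ T) (List.suffix_append _ _) ?_ (by omega)
    rw [← e]
    exact List.suffix_append _ _
  have hd1 := Words.dvd_of_hasPeriod hSq hS0 hSpre.isInfix hp hp' (by omega)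
  have hd2 := Words.dvd_of_hasPeriod hTq hT0 hTsuf.isInfix (hlS' ▸ hp') hp (by omega)
  have hlen : T.length = T₁.length := by
    rw [← hlST]
    exact Nat.dvd_antisymm (hlS' ▸ hd1) hd2
  have hTT : T = T₁ :=
    (List.suffix_of_suffix_length_le hTsuf' hTsuf hlen.le).eq_of_length hlen
  have hts : IsSingle t := by
    have : IsSingle (x * t) := h ▸ hs.isSingle.mul hx
    exact this.of_mul_right
  have htop : topWords t = topWords t' := by
    obtain ⟨w, hw⟩ := hts
    rw [hw, Finset.mem_singleton] at hT
    rw [hw, hT', ← hT, hTT]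
  have hsum : (s + s') * x = x * (t + t') := by rw [add_mul, h, h', mul_add]
  rcases add_eq_zero_or_deg_add_lt hts.ne_zero htop with h0 | h0
  · exact Or.inl (eq_of_add_eq_zero h0)
  -- The top words of `s + s'` have a length below that of `S`, and this length is a period of `X`.
  by_cases h1 : t + t' = 0
  · exact Or.inl (eq_of_add_eq_zero h1)
  right
  have hss : s + s' ≠ 0 := by
    intro e₀
    rw [e₀, zero_mul] at hsum
    exact mul_ne_zero hx0 h1 hsum.symm
  obtain ⟨R, hR⟩ := topWords_nonempty hss
  obtain ⟨R', hR', e₂⟩ := exists_rotation hX hsum hR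
  have hlR : R.length = deg (t + t') := by
    rw [length_of_mem_topWords hR, deg_eq_of_mul_eq_mul hx0 hss hsum]
  have hdt := deg_eq_of_mul_eq_mul hx0 hs.ne_zero h
  have hd3 := Words.dvd_of_hasPeriod hSq hS0 hSpre.isInfix hp
    (Words.hasPeriod_of_prefix (X := X) (Q := R) (by rw [e₂]; exact List.prefix_append _ _))
    (by omega)
  have hR0 : R.length = 0 := Nat.eq_zero_of_dvd_of_lt hd3 (by omega)
  have := eq_one_of_deg_eq_zero h1 (by omega)
  rw [← this, add_comm t, ← add_assoc, add_self, zero_add]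

/-- In the two sides of the equation the positions of corresponding appearances of `x` differ by a
multiple of the length of `S`, so the degrees of corresponding coefficients are congruent. -/
theorem deg_modEq {x : FA k} {S X : List (Fin k)} (hX : topWords x = {X})
    (hS : Words.SquareFree S) (hS0 : S ≠ []) (hSX : X <+: S ++ X) {D : ℕ}
    (hD : D + S.length ≤ X.length) :
    ∀ (l l' : List (FA k)), l.length = l'.length → (∀ a ∈ l, IsSingle a) →
      (∀ a ∈ l', IsSingle a) → (l.map deg).sum ≤ D → (l'.map deg).sum ≤ D →
      ∀ p p' : FA k, IsSingle p → IsSingle p' → deg p ≡ deg p' [MOD S.length] →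
      p * interleave x l = p' * interleave x l' →
      List.Forall₂ (fun a b => deg a ≡ deg b [MOD S.length]) l l' := by
  have hx : IsSingle x := ⟨X, hX⟩
  intro l
  induction l with
  | nil =>
    intro l' hlen
    have : l' = [] := List.length_eq_zero_iff.1 hlen.symm
    subst this
    intros
    exact List.Forall₂.nil
  | cons a l ih =>
    intro l' hlen hl hl' hlD hlD' p p' hp hp' hpp h
    cases l' with
    | nil => simp at hlen
    | cons b l' =>
    have ha := hl a (by simp)
    have hb := hl' b (by simp)
    have hlen' : l.length = l'.length := by simpa using hlen
    have hl1 : ∀ c ∈ l, IsSingle c := fun c hc => hl c (by simp [hc])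
    have hl1' : ∀ c ∈ l', IsSingle c := fun c hc => hl' c (by simp [hc])
    simp only [List.map_cons, List.sum_cons] at hlD hlD'
    by_cases hl0 : l = []
    · subst hl0
      have : l' = [] := List.length_eq_zero_iff.1 hlen'.symm
      subst this
      refine List.Forall₂.cons ?_ List.Forall₂.nil
      have := congrArg deg h
      rw [interleave_singleton, interleave_singleton, deg_mul hp.ne_zero ha.ne_zero,
        deg_mul hp'.ne_zero hb.ne_zero] at this
      exact Nat.ModEq.add_left_cancel hpp (by rw [this])
    · have hl0' : l' ≠ [] := by
        rintro rfl
        exact hl0 (List.length_eq_zero_iff.1 hlen')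
      rw [interleave_cons _ _ hl0, interleave_cons _ _ hl0'] at h
      have hI := interleave_ne_zero hx.ne_zero fun c hc => (hl1 c hc).ne_zero
      have hI' := interleave_ne_zero hx.ne_zero fun c hc => (hl1' c hc).ne_zero
      have hpa := hp.mul ha
      have hpb := hp'.mul hb
      have h1 : p * a * x * interleave x l = p' * b * x * interleave x l' := by
        simpa only [mul_assoc] using h
      have hdeg := congrArg deg h1
      rw [deg_mul (hpa.mul hx).ne_zero hI, deg_mul (hpb.mul hx).ne_zero hI',
        deg_mul hpa.ne_zero hx.ne_zero, deg_mul hpb.ne_zero hx.ne_zero,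
        deg_interleave hx.ne_zero fun c hc => (hl1 c hc).ne_zero,
        deg_interleave hx.ne_zero fun c hc => (hl1' c hc).ne_zero, hlen'] at hdeg
      have hmod : deg (p * a) ≡ deg (p' * b) [MOD S.length] := by
        obtain ⟨P, hP⟩ := id hpa
        obtain ⟨P', hP'⟩ := id hpb
        have hlP : P.length = deg (p * a) := length_of_mem_topWords (by simp [hP])
        have hlP' : P'.length = deg (p' * b) := length_of_mem_topWords (by simp [hP'])
        obtain ⟨z, hz⟩ := topWords_nonempty hI
        have hmem := append_mem_topWords_mul (u := P ++ X) (f := p * a * x)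
          (by rw [topWords_mul_single hP hX]; simp) hz
        rw [h1, mem_topWords_mul (hpb.mul hx).ne_zero hI', topWords_mul_single hP' hX] at hmem
        obtain ⟨_, hu, z', -, e⟩ := hmem
        rw [Finset.mem_singleton] at hu
        subst hu
        have hSpre : S <+: X :=
          List.prefix_of_prefix_length_le (List.prefix_append S X) hSX (by omega)
        have key : ∀ Q : List (Fin k), X <+: Q ++ X → Q.length ≤ D → S.length ∣ Q.length :=
          fun Q hQ hQD => Words.dvd_of_hasPeriod hS hS0 hSpre.isInfix
            (Words.hasPeriod_of_prefix hSX) (Words.hasPeriod_of_prefix hQ) (by omega)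
        rw [← hlP, ← hlP']
        rcases le_total P.length P'.length with hle | hle
        · obtain ⟨Q, rfl, hQ⟩ := Words.exists_shift e hle
          rw [List.length_append] at hlP' ⊢
          have := key Q hQ (by omega)
          exact (Nat.modEq_iff_dvd' (by omega)).2 (by simpa using this)
        · obtain ⟨Q, rfl, hQ⟩ := Words.exists_shift e.symm hle
          rw [List.length_append] at hlP ⊢
          have := key Q hQ (by omega)
          exact ((Nat.modEq_iff_dvd' (by omega)).2 (by simpa using this)).symm
      refine List.Forall₂.cons ?_ (ih l' hlen' hl1 hl1' (by omega) (by omega) (p * a * x)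
        (p' * b * x) (hpa.mul hx) (hpb.mul hx) ?_ h1)
      · rw [deg_mul hp.ne_zero ha.ne_zero, deg_mul hp'.ne_zero hb.ne_zero] at hmod
        exact Nat.ModEq.add_left_cancel hpp hmod
      · rw [deg_mul hpa.ne_zero hx.ne_zero, deg_mul hpb.ne_zero hx.ne_zero]
        exact hmod.add_right _

/-- If the degrees in `l` are remainders modulo `σ`, the congruences force `deg a ≤ deg b` for all
corresponding `a`, `b`. -/
theorem map_deg_eq {σ : ℕ} {l l' : List (FA k)}
    (h : List.Forall₂ (fun a b => deg a ≡ deg b [MOD σ]) l l') (hl : ∀ a ∈ l, deg a < σ) :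
    (l.map deg).sum ≤ (l'.map deg).sum ∧
      ((l.map deg).sum = (l'.map deg).sum → l.map deg = l'.map deg) := by
  induction h with
  | nil => simp
  | @cons a b l l' hab _ ih =>
    obtain ⟨h1, h2⟩ := ih fun c hc => hl c (by simp [hc])
    have hle : deg a ≤ deg b := by
      have := hl a (by simp)
      rw [← Nat.mod_eq_of_lt this, hab]
      exact Nat.mod_le _ _
    simp only [List.map_cons, List.sum_cons]
    refine ⟨by omega, fun e => ?_⟩
    rw [h2 (by omega), show deg a = deg b by omega]

end FA

/-! ### Normal forms modulo `s x = x t` -/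

namespace FA

variable {k : ℕ}

theorem topWords_mon (w : List (Fin k)) : topWords (mon w) = {w} ∧ deg (mon w) = w.length := by
  have : mon w = poly {w} := by simp [poly]
  rw [this]
  exact topWords_poly (Finset.singleton_nonempty w) (by simp)

/-- The elements `w x`, for short words `w` without the suffix `S`, are right linearly
independent. -/
theorem eq_zero_of_sum_eq_zero {x : FA k} {S X : List (Fin k)} (hX : topWords x = {X})
    (hS : Words.SquareFree S) (hS0 : S ≠ []) (hSX : X <+: S ++ X)
    {W : Finset (List (Fin k))} (hW : ∀ w ∈ W, ¬ S <:+ w ∧ w.length + S.length ≤ X.length)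
    {f : List (Fin k) → FA k} (h : ∑ w ∈ W, mon w * x * f w = 0) : ∀ w ∈ W, f w = 0 := by
  classical
  by_contra! hne
  -- A term of maximal degree has a top word that cannot cancel against the other terms.
  have hx : IsSingle x := ⟨X, hX⟩
  obtain ⟨w₁, hw₁, hf₁⟩ := hne
  obtain ⟨w, hw, hmax⟩ := Finset.exists_max_image (W.filter fun w => f w ≠ 0)
    (fun w => w.length + deg (f w)) ⟨w₁, by simp [hw₁, hf₁]⟩
  rw [Finset.mem_filter] at hw
  obtain ⟨z, hz⟩ := topWords_nonempty hw.2
  have hmon : ∀ v : List (Fin k), topWords (mon v * x) = {v ++ X} := fun v =>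
    topWords_mul_single (topWords_mon v).1 hX
  have hmem := append_mem_topWords_mul (f := mon w * x) (u := w ++ X) (by simp [hmon]) hz
  have hc := congrArg (fun g => coef g (w ++ X ++ z)) h
  simp only [coef_sum, coef_zero] at hc
  rw [Finset.sum_eq_single_of_mem w hw.1] at hc
  · exact mem_words.1 (mem_topWords.1 hmem).1 hc
  · intro v hv hvw
    by_contra hcv
    by_cases hfv : f v = 0
    · rw [hfv, mul_zero] at hcv
      exact hcv (coef_zero _)
    have hm0 : mon v * x ≠ 0 := IsSingle.ne_zero ⟨_, hmon v⟩
    have hle := hmax v (by simp [hv, hfv])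
    have hlen : deg (mon v * x * f v) ≤ (w ++ X ++ z).length := by
      have h1 : (v ++ X).length = deg (mon v * x) := length_of_mem_topWords (by simp [hmon])
      rw [deg_mul hm0 hfv, ← h1]
      have h2 := length_of_mem_topWords hz
      simp only [List.length_append]
      omega
    have hmem' : w ++ X ++ z ∈ topWords (mon v * x * f v) :=
      mem_topWords.2 ⟨mem_words.2 hcv, le_antisymm (length_le_deg (mem_words.2 hcv)) hlen⟩
    rw [mem_topWords_mul hm0 hfv] at hmem'
    obtain ⟨u, hu, z', -, e⟩ := hmem'
    rw [hmon, Finset.mem_singleton] at hu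
    subst hu
    exact hvw (Words.eq_of_append_eq hS hS0 hSX (hW w hw.1).1 (hW v hv).1 (hW w hw.1).2
      (hW v hv).2 e).symm

/-- `IsForm n e Φ`: the function `Φ` of `x` is a sum of terms `c₀ x c₁ x ⋯ x cₙ` in which the total
degree of the coefficients is at most `e`. -/
inductive IsForm : ℕ → ℕ → (FA k → FA k) → Prop
  | const {e : ℕ} (c : FA k) (h : deg c ≤ e) : IsForm 0 e fun _ => c
  | zero (n e : ℕ) : IsForm n e fun _ => 0
  | add {n e : ℕ} {Φ Ψ : FA k → FA k} (h : IsForm n e Φ) (h' : IsForm n e Ψ) :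
      IsForm n e fun x => Φ x + Ψ x
  | step {n e e' : ℕ} {Ψ : FA k → FA k} (c : FA k) (h : IsForm n e' Ψ) (h' : deg c + e' ≤ e) :
      IsForm (n + 1) e fun x => c * x * Ψ x

theorem IsForm.mono {n e e' : ℕ} {Φ : FA k → FA k} (h : IsForm n e Φ) (he : e ≤ e') :
    IsForm n e' Φ := by
  induction h with
  | const c h => exact .const c (h.trans he)
  | zero => exact .zero _ _
  | add _ _ ih ih' => exact .add (ih he) (ih' he)
  | step c h h' _ => exact .step c h (h'.trans he)

theorem IsForm.mul_left {n e : ℕ} {Φ : FA k → FA k} (h : IsForm n e Φ) (t : FA k) :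
    IsForm n (deg t + e) fun x => t * Φ x := by
  induction h with
  | const c h => exact .const (t * c) ((deg_mul_le t c).trans (by omega))
  | zero =>
    simp only [mul_zero]
    exact .zero _ _
  | add _ _ ih ih' =>
    simp only [mul_add]
    exact .add ih ih'
  | step c h h' _ =>
    simp only [← mul_assoc]
    exact .step (t * c) h (by have := deg_mul_le t c; omega)

theorem IsForm.exists_const {e : ℕ} {Φ : FA k → FA k} (h : IsForm 0 e Φ) :
    ∃ c, ∀ x, Φ x = c := by
  generalize hn : 0 = n at h
  induction h with
  | const c _ => exact ⟨c, fun _ => rfl⟩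
  | zero => exact ⟨0, fun _ => rfl⟩
  | add _ _ ih ih' =>
    obtain ⟨c, hc⟩ := ih hn
    obtain ⟨c', hc'⟩ := ih' hn
    exact ⟨c + c', fun x => by simp only [hc, hc']⟩
  | step => omega

theorem isForm_interleave (a : FA k) (l : List (FA k)) :
    IsForm l.length ((a :: l).map deg).sum fun x => interleave x (a :: l) := by
  induction l generalizing a with
  | nil =>
    simp only [interleave_singleton]
    exact .const a (by simp)
  | cons b l ih =>
    simp only [interleave_cons _ _ (List.cons_ne_nil b l)]
    exact .step a (ih b) (by simp)

/-- The words of length at most `e` without the suffix `S`. -/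
noncomputable def normalWords (S : List (Fin k)) (e : ℕ) : Finset (List (Fin k)) := by
  classical
  exact (List.finite_length_le (Fin k) e).toFinset.filter fun w => ¬ S <:+ w

theorem mem_normalWords {S w : List (Fin k)} {e : ℕ} :
    w ∈ normalWords S e ↔ w.length ≤ e ∧ ¬ S <:+ w := by
  simp [normalWords]

/-- On the solutions of `s x = x t` the function `Φ` is a sum of terms `w x Ψ_w(x)` where the words
`w` have length at most `e` and not the suffix `S`, and `Ψ_w` is a form of degree `n` in `x` whose
coefficients have total degree at most `e - |w|`. -/
def HasNormalForm (s t : FA k) (S : List (Fin k)) (n e : ℕ) (Φ : FA k → FA k) : Prop :=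
  ∃ Ψ : List (Fin k) → FA k → FA k, (∀ w ∈ normalWords S e, IsForm n (e - w.length) (Ψ w)) ∧
    ∀ x, s * x = x * t → Φ x = ∑ w ∈ normalWords S e, mon w * x * Ψ w x

theorem HasNormalForm.zero (s t : FA k) (S : List (Fin k)) (n e : ℕ) :
    HasNormalForm s t S n e fun _ => 0 :=
  ⟨fun _ _ => 0, fun _ _ => .zero _ _, fun x _ => by simp⟩

theorem HasNormalForm.add {s t : FA k} {S : List (Fin k)} {n e : ℕ} {Φ Φ' : FA k → FA k}
    (h : HasNormalForm s t S n e Φ) (h' : HasNormalForm s t S n e Φ') :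
    HasNormalForm s t S n e fun x => Φ x + Φ' x := by
  obtain ⟨Ψ, h1, h2⟩ := h
  obtain ⟨Ψ', h1', h2'⟩ := h'
  refine ⟨fun w x => Ψ w x + Ψ' w x, fun w hw => .add (h1 w hw) (h1' w hw), fun x hx => ?_⟩
  simp only [h2 x hx, h2' x hx, mul_add, Finset.sum_add_distrib]

theorem HasNormalForm.sum {s t : FA k} {S : List (Fin k)} {n e : ℕ} {ι : Type*} (I : Finset ι)
    {Φ : ι → FA k → FA k} (h : ∀ i ∈ I, HasNormalForm s t S n e (Φ i)) :
    HasNormalForm s t S n e fun x => ∑ i ∈ I, Φ i x := by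
  classical
  induction I using Finset.induction_on with
  | empty => simpa using HasNormalForm.zero s t S n e
  | insert a I ha ih =>
    simp only [Finset.sum_insert ha]
    exact (h a (by simp)).add (ih fun i hi => h i (by simp [hi]))

theorem HasNormalForm.congr {s t : FA k} {S : List (Fin k)} {n e : ℕ} {Φ Φ' : FA k → FA k}
    (h : HasNormalForm s t S n e Φ) (h' : ∀ x, s * x = x * t → Φ' x = Φ x) :
    HasNormalForm s t S n e Φ' := by
  obtain ⟨Ψ, h1, h2⟩ := h
  exact ⟨Ψ, h1, fun x hx => (h' x hx).trans (h2 x hx)⟩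

/-- A suffix `S` of the coefficient in front of `x` is replaced by `s` and shorter words, and `s`
is moved across `x`. -/
theorem hasNormalForm_mon {s t : FA k} {S : List (Fin k)} (hS : topWords s = {S}) (hS0 : S ≠ [])
    (hst : deg t = deg s) {n e : ℕ} (u : List (Fin k)) {e' : ℕ} {Ψ : FA k → FA k}
    (hΨ : IsForm n e' Ψ) (hu : u.length + e' ≤ e) :
    HasNormalForm s t S n e fun x => mon u * x * Ψ x := by
  classical
  have hlS : S.length = deg s := length_of_mem_topWords (by simp [hS])
  have hpos := List.length_pos_of_ne_nil hS0
  induction hm : u.length using Nat.strong_induction_on generalizing u e' Ψ with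
  | _ m ih =>
  subst hm
  by_cases hsuf : S <:+ u
  · obtain ⟨u', rfl⟩ := hsuf
    rw [List.length_append] at hu
    have hρ : ∀ v ∈ words (s + mon S), v.length < S.length := by
      intro v hv
      have hs0 : s ≠ 0 := IsSingle.ne_zero ⟨S, hS⟩
      have htop : topWords s = topWords (mon S) := by rw [hS, (topWords_mon S).1]
      rcases add_eq_zero_or_deg_add_lt hs0 htop with h0 | h0
      · rw [h0, mem_words] at hv
        exact absurd (coef_zero v) hv
      · have := length_le_deg hv
        omega
    have h1 := ih u'.length (by rw [List.length_append]; omega) u' (hΨ.mul_left t) (by omega) rfl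
    have h2 := HasNormalForm.sum (words (s + mon S)) fun v hv =>
      ih (u' ++ v).length (by simp only [List.length_append]; have := hρ v hv; omega) (u' ++ v) hΨ
        (by rw [List.length_append]; have := hρ v hv; omega) rfl
    refine (h1.add h2).congr fun x hx => ?_
    have e1 : ∑ v ∈ words (s + mon S), mon (u' ++ v) * x * Ψ x
        = mon u' * (s + mon S) * x * Ψ x := by
      conv_rhs => rw [← poly_words (s + mon S), poly]
      simp only [mon_append, Finset.mul_sum, Finset.sum_mul]
    have e2 : mon u' * x * (t * Ψ x) = mon u' * s * x * Ψ x := by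
      rw [mul_assoc (mon u') s x, hx]
      simp only [mul_assoc]
    rw [e1, e2, mon_append, mul_add, add_mul, add_mul, ← add_assoc, add_self, zero_add]
  · refine ⟨fun w x => if w = u then Ψ x else 0, ?_, ?_⟩
    · intro w hw
      by_cases hwu : w = u
      · subst hwu
        simp only [if_true]
        exact hΨ.mono (by omega)
      · simp only [if_neg hwu]
        exact .zero _ _
    · intro x _
      rw [Finset.sum_eq_single_of_mem u (mem_normalWords.2 ⟨by omega, hsuf⟩)]
      · simp
      · intro w _ hw
        simp [hw]

theorem IsForm.hasNormalForm {s t : FA k} {S : List (Fin k)} (hS : topWords s = {S})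
    (hS0 : S ≠ []) (hst : deg t = deg s) {n e : ℕ} {Φ : FA k → FA k} (h : IsForm (n + 1) e Φ) :
    HasNormalForm s t S n e Φ := by
  generalize hm : n + 1 = m at h
  induction h with
  | const => omega
  | zero => exact .zero _ _ _ _ _
  | add _ _ ih ih' => exact (ih hm).add (ih' hm)
  | @step n' e e' Ψ c h h' _ =>
    obtain rfl : n = n' := by omega
    refine (HasNormalForm.sum (words c) fun u hu => hasNormalForm_mon hS hS0 hst u h
      (e := e) ?_).congr fun x _ => ?_
    · have := length_le_deg hu
      omega
    · conv_lhs => rw [← poly_words c, poly]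
      simp only [Finset.sum_mul]

/-- If a form of small degree vanishes at one long solution of `s x = x t`, then it vanishes at all
the solutions: already its normal form is zero. -/
theorem IsForm.eq_zero {s t x : FA k} {S X : List (Fin k)} (hS : topWords s = {S})
    (hSq : Words.SquareFree S) (hS0 : S ≠ []) (hst : deg t = deg s) (hX : topWords x = {X})
    (hSX : X <+: S ++ X) (hx : s * x = x * t) {n : ℕ} :
    ∀ {e : ℕ} {Φ : FA k → FA k}, IsForm n e Φ → e + S.length ≤ X.length → Φ x = 0 →
      ∀ y, s * y = y * t → Φ y = 0 := by
  induction n with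
  | zero =>
    intro e Φ h _ h0 y _
    obtain ⟨c, hc⟩ := h.exists_const
    rw [hc, ← hc x, h0]
  | succ n ih =>
    intro e Φ h he h0 y hy
    obtain ⟨Ψ, h1, h2⟩ := h.hasNormalForm hS hS0 hst
    rw [h2 x hx] at h0
    have key := eq_zero_of_sum_eq_zero hX hSq hS0 hSX (W := normalWords S e)
      (fun w hw => ⟨(mem_normalWords.1 hw).2, by have := (mem_normalWords.1 hw).1; omega⟩)
      (f := fun w => Ψ w x) h0
    rw [h2 y hy]
    apply Finset.sum_eq_zero
    intro w hw
    rw [ih (h1 w hw) (by omega) (key w hw) y hy, mul_zero]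

end FA

/-! ### The solutions of the equation -/

namespace FA

variable {k : ℕ}

theorem isForm_interleave_add {l l' : List (FA k)} (hl : l ≠ []) (hlen : l.length = l'.length) :
    IsForm (l.length - 1) (max (l.map deg).sum (l'.map deg).sum)
      fun x => interleave x l + interleave x l' := by
  cases l with
  | nil => exact absurd rfl hl
  | cons a l =>
    cases l' with
    | nil => simp at hlen
    | cons b l' =>
      have hlen' : l'.length = l.length := by simpa using hlen.symm
      refine .add ((isForm_interleave a l).mono (le_max_left _ _)) ?_
      have := (isForm_interleave b l').mono (le_max_right ((a :: l).map deg).sum _)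
      rwa [hlen'] at this

/-- The main statement for lists of coefficients. Here it suffices that the degree of the given
solution, and the degrees of the further ones, are at least twice the total degree of the
coefficients. -/
theorem exists_conjugation {l l' : List (FA k)} (hlen : l.length = l'.length) (hne : l ≠ l')
    (hl : ∀ a ∈ l, IsSqFree a) (hl' : ∀ a ∈ l', IsSqFree a) {x : FA k} (hx0 : x ≠ 0)
    (hx : interleave x l = interleave x l') (hdeg : 2 * (l.map deg).sum ≤ deg x) :
    ∃ s t : FA k, s ≠ 0 ∧ t ≠ 0 ∧ deg s = deg t ∧ (∃ a ∈ l, deg s ≤ deg a) ∧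
      (∀ y, s * y = y * t → interleave y l = interleave y l') ∧
      ∀ y, y ≠ 0 → interleave y l = interleave y l' → 2 * (l.map deg).sum ≤ deg y →
        s * y = y * t := by
  have hsum := sum_deg_eq hx0 (fun a ha => (hl a ha).ne_zero) (fun a ha => (hl' a ha).ne_zero)
    hlen hx
  obtain ⟨s, hs, hs1, hsD, hbound, hleft⟩ :=
    exists_left_multiplier hlen hne hl hl' hx0 hx (by omega)
  obtain ⟨t', ht', ht1, htD, hright⟩ :=
    exists_right_multiplier hlen hne hl hl' hx0 hx (by omega)
  obtain ⟨hxs, t, e⟩ := hleft x hx0 hx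
  obtain ⟨X, hX⟩ := id hxs
  obtain ⟨S, hS, hSq⟩ := id hs
  have hlX : X.length = deg x := length_of_mem_topWords (by simp [hX])
  have hlS : S.length = deg s := length_of_mem_topWords (by simp [hS])
  have hS0 : S ≠ [] := by
    rintro rfl
    rw [List.length_nil] at hlS
    omega
  have hSX : X <+: S ++ X := by
    obtain ⟨T, -, e'⟩ := exists_rotation hX e (A := S) (by simp [hS])
    rw [e']
    exact List.prefix_append _ _
  have hst := deg_eq_of_mul_eq_mul hx0 hs.ne_zero e
  have ht0 : t ≠ 0 := by
    rintro rfl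
    rw [deg_zero] at hst
    omega
  refine ⟨s, t, hs.ne_zero, ht0, hst, ?_, ?_, ?_⟩
  · -- If all the degrees were smaller than `deg s`, congruences modulo `deg s` would be equalities.
    by_contra! hcon
    refine (hbound.resolve_left fun ⟨a, ha, h⟩ => (hcon a ha).not_ge h) ?_
    have hone : IsSingle (1 : FA k) := ⟨[], topWords_one⟩
    have hF := deg_modEq hX hSq hS0 hSX (D := (l.map deg).sum) (by omega) l l' hlen
      (fun a ha => (hl a ha).isSingle) (fun a ha => (hl' a ha).isSingle) le_rfl hsum.ge 1 1
      hone hone rfl (by rw [hx])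
    exact (map_deg_eq hF (by rwa [hlS])).2 hsum
  · intro y hy
    have hl0 : l ≠ [] := by
      rintro rfl
      exact hne (List.length_eq_zero_iff.1 hlen.symm).symm
    exact eq_of_add_eq_zero ((isForm_interleave_add hl0 hlen).eq_zero hS hSq hS0 hst.symm hX hSX e
      (by rw [← hsum, max_self]; omega) (by rw [hx, add_self]) y hy)
  · intro y hy0 hy hyd
    obtain ⟨hys, t₂, e₂⟩ := hleft y hy0 hy
    obtain ⟨s', e'⟩ := hright x hx0 hx
    obtain ⟨s₂, e₂'⟩ := hright y hy0 hy
    -- `t` and `t₂` are both equal to `t'` up to a constant, and they have the same image.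
    have c1 : collapse k s = collapse k t := by
      have := congrArg (collapse k) e
      rw [map_mul, map_mul, mul_comm] at this
      exact mul_left_cancel₀ hxs.collapse_ne_zero this
    have c2 : collapse k s = collapse k t₂ := by
      have := congrArg (collapse k) e₂
      rw [map_mul, map_mul, mul_comm] at this
      exact mul_left_cancel₀ hys.collapse_ne_zero this
    have c3 : collapse k t = collapse k t₂ := c1.symm.trans c2
    have h1 := eq_or_eq_add_one hs ht' hs1 ht1 hxs (by omega) e e'
    have h2 := eq_or_eq_add_one hs ht' hs1 ht1 hys (by omega) e₂ e₂'
    have : t = t₂ := by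
      rcases h1 with rfl | rfl <;> rcases h2 with rfl | rfl
      · rfl
      · simp at c3
      · simp at c3
      · rfl
    rw [this, e₂]

end FA

theorem theorem4p7 (k n : ℕ) (u v : Fin n → FA k)
    (hu : ∀ i, ∃ w, FA.topWords (u i) = {w} ∧ Words.SquareFree w)
    (hv : ∀ i, ∃ w, FA.topWords (v i) = {w} ∧ Words.SquareFree w)
    (huv : ∃ i, u i ≠ v i)
    (x₁ : FA k) (hx₁ : FA.side u x₁ = FA.side v x₁)
    (hdeg : 2 * (∑ i, FA.deg (u i)) ^ 2 < FA.deg x₁)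
    (hper : ∀ (U V : Fin n → List (Fin k)) (X : List (Fin k)),
      (∀ i, U i ∈ FA.topWords (u i)) → (∀ i, V i ∈ FA.topWords (v i)) →
      X ∈ FA.topWords x₁ →
      Words.PeriodicityContained U X ∧ Words.PeriodicityContained V X) :
    ∃ s t : FA k, s ≠ 0 ∧ t ≠ 0 ∧ FA.deg s = FA.deg t ∧
      FA.deg s ≤ Finset.univ.sup (fun i => FA.deg (u i)) ∧
      (∀ x : FA k, s * x = x * t → FA.side u x = FA.side v x) ∧
      (∀ x₂ : FA k, FA.side u x₂ = FA.side v x₂ →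
        2 * (2 + 2 ^ (FA.deg s + 2)) + 2 * (∑ i, FA.deg (u i)) ^ 2 < FA.deg x₂ →
        s * x₂ = x₂ * t) := by
  have hsum : ((List.ofFn u).map FA.deg).sum = ∑ i, FA.deg (u i) := by
    rw [List.map_ofFn, List.sum_ofFn]
    rfl
  have hsq : ∑ i, FA.deg (u i) ≤ (∑ i, FA.deg (u i)) ^ 2 := Nat.le_self_pow two_ne_zero _
  have hne : List.ofFn u ≠ List.ofFn v := by
    obtain ⟨i, hi⟩ := huv
    exact fun h => hi (congrFun (List.ofFn_injective h) i)
  have hmem : ∀ w : Fin n → FA k, (∀ i, FA.IsSqFree (w i)) →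
      ∀ a ∈ List.ofFn w, FA.IsSqFree a := by
    intro w hw a ha
    obtain ⟨i, rfl⟩ := (List.mem_ofFn' w a).1 ha
    exact hw i
  have hpos : ∀ y : FA k, 2 * (∑ i, FA.deg (u i)) ^ 2 < FA.deg y → y ≠ 0 := by
    rintro y h rfl
    rw [FA.deg_zero] at h
    omega
  obtain ⟨s, t, hs, ht, hst, ⟨a, ha, hsa⟩, h1, h2⟩ := FA.exists_conjugation (by simp) hne
    (hmem u hu) (hmem v hv) (hpos x₁ hdeg) hx₁ (by rw [hsum]; omega)
  refine ⟨s, t, hs, ht, hst, ?_, h1, fun x₂ hx₂ hd => ?_⟩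
  · obtain ⟨i, rfl⟩ := (List.mem_ofFn' u a).1 ha
    exact hsa.trans (Finset.le_sup (f := fun i => FA.deg (u i)) (Finset.mem_univ i))
  · exact h2 x₂ (hpos x₂ (by omega)) hx₂ (by rw [hsum]; omega)
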